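/- **Conventions.** "Small" refers to a fixed universe. For a category $M$ with a class of maps $W$ (weak equivalences) and a small category $D$, let $M^D$ be the category of $D$-diagrams in $M$ with the pointwise weak equivalences, and let $\gamma_D\colon M^D\to \mathbf{ho}M^D$ be its (Gabriel–Zisman) localization at the pointwise weak equivalences. An *(Anderson–Brown–Cisinski) cofibration category* is a category $M$ with two classes of maps, weak equivalences $W$ and cofibrations $\mathrm{Cof}$, such that, calling $A$ cofibrant if the map $\emptyset\to A$ from the initial object is a cofibration, and calling a cofibration trivial if it is in $W$: - (CF1) $M$ has an initial object, which is cofibrant; cofibrations are closed under composition; isomorphisms are weak equivalences, and isomorphisms with cofibrant domain are cofibrations. - (CF2) If two of $f,g,gf$ are weak equivalences, so is the third. - (CF3) If $i\colon A\to B$ is a cofibration and $A\to C$ is a map with $A,C$ cofibrant, then the pushout $D=B\sqcup_A C$ exists and $C\to D$ is a cofibration, which is trivial if $i$ is trivial. - (CF4) Every map $f\colon A\to B$ with $A$ cofibrant factors as $f=rf'$ with $f'$ a cofibration and $r$ a weak equivalence. - (CF5) If $f_i\colon A_i\to B_i$ $(i\in I)$ is a small set of cofibrations with all $A_i$ cofibrant,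 then $\coprod A_i$ and $\coprod B_i$ exist and are cofibrant, and $\coprod f_i$ is a cofibration, which is trivial if all $f_i$ are trivial. - (CF6) For every sequence of cofibrations $A_0\to A_1\to A_2\to\cdots$ with $A_0$ cofibrant, $\operatorname{colim}A_n$ exists and $A_0\to\operatorname{colim}A_n$ is a cofibration, which is trivial if all $A_n\to A_{n+1}$ are trivial. A *fibration category* $(M,W,\mathrm{Fib})$ is defined by the dual axioms. Let $u\colon D_1\to D_2$ be a functor of small categories, $u^*\colon M^{D_2}\to M^{D_1}$ the restriction functor, and $\mathbf{ho}u^*\colon\mathbf{ho}M^{D_2}\to\mathbf{ho}M^{D_1}$ the functor with $\mathbf{ho}u^*\circ\gamma_{D_2}=\gamma_{D_1}\circ u^*$. Let $i\colon M^{D_1}_{\operatorname{colim}^u}\hookrightarrow M^{D_1}$ be the full subcategory of those $X$ for which $\operatorname{colim}^uX$ exists, i.e. for which the functor $Y\mapsto\operatorname{Hom}(X,u^*Y)$ on $M^{D_2}$ is corepresented by an object $\operatorname{colim}^uX$, with universal map $\eta_X\colon X\to u^*\operatorname{colim}^uX$; this gives a functor $\operatorname{colim}^u\colon M^{D_1}_{\operatorname{colim}^u}\to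 M^{D_2}$. Dually define $i\colon M^{D_1}_{\lim^u}\hookrightarrow M^{D_1}$, $\lim^u\colon M^{D_1}_{\lim^u}\to M^{D_2}$ and $\theta_X\colon u^*\lim^uX\to X$. A *homotopy colimit* of $u$ is a pair $(\mathbf L\operatorname{colim}^u,\epsilon_u)$ of a functor $\mathbf L\operatorname{colim}^u\colon\mathbf{ho}M^{D_1}\to\mathbf{ho}M^{D_2}$ and a natural map $\epsilon_u\colon\mathbf L\operatorname{colim}^u\circ\gamma_{D_1}i\Rightarrow\gamma_{D_2}\operatorname{colim}^u$ such that for every pair $(\Lambda,\lambda)$ of a functor $\Lambda\colon\mathbf{ho}M^{D_1}\to\mathbf{ho}M^{D_2}$ and a natural map $\lambda\colon\Lambda\circ\gamma_{D_1}i\Rightarrow\gamma_{D_2}\operatorname{colim}^u$ there is a unique $\delta\colon\Lambda\Rightarrow\mathbf L\operatorname{colim}^u$ with $\epsilon_u\circ(\delta\,\gamma_{D_1}i)=\lambda$. A *homotopy limit* of $u$ is a pair $(\mathbf R\lim^u,\nu_u)$ with $\nu_u\colon\gamma_{D_2}\lim^u\Rightarrow\mathbf R\lim^u\circ\gamma_{D_1}i$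 having the dual (initial) universal property. **Theorem (Existence of homotopy (co)limits).** Let $u\colon D_1\to D_2$ be a functor of small categories. 1. If $M$ is a cofibration category, then the homotopy colimit $(\mathbf L\operatorname{colim}^u,\epsilon_u)$ exists, and $$\mathbf L\operatorname{colim}^u\colon\mathbf{ho}M^{D_1}\rightleftarrows\mathbf{ho}M^{D_2}\colon\mathbf{ho}u^*$$ is naturally an adjoint pair: there is an adjunction $\mathbf L\operatorname{colim}^u\dashv\mathbf{ho}u^*$ whose unit $\Phi$ satisfies $\mathbf{ho}u^*(\epsilon_{u,X})\circ\Phi_{\gamma_{D_1}X}=\gamma_{D_1}(\eta_X)$ for all $X\in M^{D_1}_{\operatorname{colim}^u}$. 2. If $M$ is a fibration category, then the homotopy limit $(\mathbf R\lim^u,\nu_u)$ exists, and $$\mathbf{ho}u^*\colon\mathbf{ho}M^{D_2}\rightleftarrows\mathbf{ho}M^{D_1}\colon\mathbf R\lim^u$$ is naturally an adjoint pair: there is an adjunction $\mathbf{ho}u^*\dashv\mathbf R\lim^u$ whose counit $\Psi$ satisfies $\Psi_{\gamma_{D_1}X}\circ\mathbf{ho}u^*(\nu_{u,X})=\gamma_{D_1}(\theta_X)$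 for all $X\in M^{D_1}_{\lim^u}$. -/

import Mathlib

open CategoryTheory CategoryTheory.Limits

universe w v u

namespace ABC

section Axioms

variable {M : Type u} [Category.{v} M]

/-- An object `A` is cofibrant if the map `∅ ⟶ A` from an initial object is a cofibration.
(Under the axioms below this does not depend on the initial object.) -/
def IsCofibrant (Cof : MorphismProperty M) (A : M) : Prop :=
  ∃ (I : M) (hI : IsInitial I), Cof (hI.to A)

/-- An object `A` is fibrant if the map `A ⟶ *` to a terminal object is a fibration. -/
def IsFibrant (Fib : MorphismProperty M) (A : M) : Prop :=
  ∃ (T : M) (hT : IsTerminal T), Fib (hT.from A)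

/-- Anderson-Brown-Cisinski cofibration categories `(M, W, Cof)`: axioms CF1-CF6.
The universe `w` is the universe of small sets. -/
structure IsCofibrationCategory (W Cof : MorphismProperty M) : Prop where
  /-- CF1: there is an initial object, and it is cofibrant. -/
  exists_initial : ∃ I : M, Nonempty (IsInitial I) ∧ IsCofibrant Cof I
  /-- CF1: cofibrations are stable under composition. -/
  cof_comp : ∀ {A B C : M} (f : A ⟶ B) (g : B ⟶ C), Cof f → Cof g → Cof (f ≫ g)
  /-- CF1: isomorphisms are weak equivalences. -/
  weq_of_isIso : ∀ {A B : M} (f : A ⟶ B), IsIso f → W f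
  /-- CF1: isomorphisms with cofibrant domain are (trivial) cofibrations. -/
  cof_of_isIso : ∀ {A B : M} (f : A ⟶ B), IsIso f → IsCofibrant Cof A → Cof f
  /-- CF2: two out of three. -/
  two_out_of_three : W.HasTwoOutOfThreeProperty
  /-- CF3, existence of pushouts. -/
  hasPushout : ∀ {A B C : M} (i : A ⟶ B) (g : A ⟶ C), Cof i → IsCofibrant Cof A →
    IsCofibrant Cof C → HasPushout i g
  /-- CF3 (1). -/
  cof_pushout : ∀ {A B C D : M} (i : A ⟶ B) (g : A ⟶ C) (k : B ⟶ D) (j : C ⟶ D),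
    Cof i → IsCofibrant Cof A → IsCofibrant Cof C → IsPushout i g k j → Cof j
  /-- CF3 (2). -/
  weq_pushout : ∀ {A B C D : M} (i : A ⟶ B) (g : A ⟶ C) (k : B ⟶ D) (j : C ⟶ D),
    Cof i → W i → IsCofibrant Cof A → IsCofibrant Cof C → IsPushout i g k j → W j
  /-- CF4: factorization. -/
  factorization : ∀ {A B : M} (f : A ⟶ B), IsCofibrant Cof A →
    ∃ (X : M) (f' : A ⟶ X) (r : X ⟶ B), Cof f' ∧ W r ∧ f' ≫ r = f
  /-- CF5: small sums of (trivial) cofibrations with cofibrant domain. -/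
  coproduct : ∀ {I : Type w} (A B : I → M) (f : ∀ i, A i ⟶ B i),
    (∀ i, IsCofibrant Cof (A i)) → (∀ i, Cof (f i)) →
    ∃ (_ : HasCoproduct A) (_ : HasCoproduct B),
      IsCofibrant Cof (∐ A) ∧ IsCofibrant Cof (∐ B) ∧ Cof (Limits.Sigma.map f) ∧
        ((∀ i, W (f i)) → W (Limits.Sigma.map f))
  /-- CF6: countable direct compositions of (trivial) cofibrations with cofibrant domain. -/
  sequence : ∀ A : ℕ ⥤ M, IsCofibrant Cof (A.obj 0) →
    (∀ n : ℕ, Cof (A.map (homOfLE n.le_succ))) →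
    ∃ _ : HasColimit A, Cof (colimit.ι A 0) ∧
      ((∀ n : ℕ, W (A.map (homOfLE n.le_succ))) → W (colimit.ι A 0))

/-- Anderson-Brown-Cisinski fibration categories `(M, W, Fib)`: axioms F1-F6.
The universe `w` is the universe of small sets. -/
structure IsFibrationCategory (W Fib : MorphismProperty M) : Prop where
  /-- F1: there is a terminal object, and it is fibrant. -/
  exists_terminal : ∃ T : M, Nonempty (IsTerminal T) ∧ IsFibrant Fib T
  /-- F1: fibrations are stable under composition. -/
  fib_comp : ∀ {A B C : M} (f : A ⟶ B) (g : B ⟶ C), Fib f → Fib g → Fib (f ≫ g)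
  /-- F1: isomorphisms are weak equivalences. -/
  weq_of_isIso : ∀ {A B : M} (f : A ⟶ B), IsIso f → W f
  /-- F1: isomorphisms with fibrant codomain are (trivial) fibrations. -/
  fib_of_isIso : ∀ {A B : M} (f : A ⟶ B), IsIso f → IsFibrant Fib B → Fib f
  /-- F2: two out of three. -/
  two_out_of_three : W.HasTwoOutOfThreeProperty
  /-- F3, existence of pullbacks. -/
  hasPullback : ∀ {A B C : M} (p : B ⟶ A) (g : C ⟶ A), Fib p → IsFibrant Fib A →
    IsFibrant Fib C → HasPullback p g
  /-- F3 (1). -/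
  fib_pullback : ∀ {A B C D : M} (p : B ⟶ A) (g : C ⟶ A) (k : D ⟶ B) (q : D ⟶ C),
    Fib p → IsFibrant Fib A → IsFibrant Fib C → IsPullback k q p g → Fib q
  /-- F3 (2). -/
  weq_pullback : ∀ {A B C D : M} (p : B ⟶ A) (g : C ⟶ A) (k : D ⟶ B) (q : D ⟶ C),
    Fib p → W p → IsFibrant Fib A → IsFibrant Fib C → IsPullback k q p g → W q
  /-- F4: factorization. -/
  factorization : ∀ {A B : M} (f : A ⟶ B), IsFibrant Fib B →
    ∃ (X : M) (s : A ⟶ X) (f' : X ⟶ B), W s ∧ Fib f' ∧ s ≫ f' = f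
  /-- F5: small products of (trivial) fibrations with fibrant codomain. -/
  product : ∀ {I : Type w} (A B : I → M) (f : ∀ i, A i ⟶ B i),
    (∀ i, IsFibrant Fib (B i)) → (∀ i, Fib (f i)) →
    ∃ (_ : HasProduct A) (_ : HasProduct B),
      IsFibrant Fib (∏ᶜ A) ∧ IsFibrant Fib (∏ᶜ B) ∧ Fib (Limits.Pi.map f) ∧
        ((∀ i, W (f i)) → W (Limits.Pi.map f))
  /-- F6: countable inverse compositions of (trivial) fibrations with fibrant codomain. -/
  sequence : ∀ A : ℕᵒᵖ ⥤ M, IsFibrant Fib (A.obj (Opposite.op 0)) →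
    (∀ n : ℕ, Fib (A.map (homOfLE n.le_succ).op)) →
    ∃ _ : HasLimit A, Fib (limit.π A (Opposite.op 0)) ∧
      ((∀ n : ℕ, W (A.map (homOfLE n.le_succ).op)) → W (limit.π A (Opposite.op 0)))

end Axioms

noncomputable section

variable {M : Type u} [Category.{v} M] (W : MorphismProperty M)

/-- `ho M^D`: the Gabriel-Zisman localization of the category of `D`-diagrams at the
pointwise weak equivalences. -/
abbrev Ho (D : Type w) [SmallCategory D] : Type _ := (W.functorCategory D).Localization

/-- The localization functor `γ_D : M^D ⥤ ho M^D`. -/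
abbrev γ (D : Type w) [SmallCategory D] : (D ⥤ M) ⥤ Ho W D := (W.functorCategory D).Q

variable (M) in
/-- The restriction functor `u^* : M^{D₂} ⥤ M^{D₁}`. -/
abbrev res {D₁ D₂ : Type w} [SmallCategory D₁] [SmallCategory D₂] (u : D₁ ⥤ D₂) :
    (D₂ ⥤ M) ⥤ (D₁ ⥤ M) :=
  (Functor.whiskeringLeft D₁ D₂ M).obj u

variable {D₁ D₂ : Type w} [SmallCategory D₁] [SmallCategory D₂] (u : D₁ ⥤ D₂)

/-- `ho u^* : ho M^{D₂} ⥤ ho M^{D₁}`, the unique functor with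
`γ_{D₂} ⋙ ho u^* = u^* ⋙ γ_{D₁}`. -/
def hoRes : Ho W D₂ ⥤ Ho W D₁ :=
  Localization.Construction.lift (res M u ⋙ γ W D₁) fun _ _ f hf =>
    Localization.inverts (γ W D₁) (W.functorCategory D₁) ((res M u).map f) fun d => hf (u.obj d)

lemma γ_comp_hoRes : γ W D₂ ⋙ hoRes W u = res M u ⋙ γ W D₁ :=
  Localization.Construction.fac _ _

/-- The canonical isomorphism (in fact an identity) `u^* ⋙ γ_{D₁} ≅ γ_{D₂} ⋙ ho u^*`. -/
def resIso : res M u ⋙ γ W D₁ ≅ γ W D₂ ⋙ hoRes W u :=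
  eqToIso (γ_comp_hoRes W u).symm

variable (M)

/-- The full subcategory `M^{D₁}_{colim^u}` of those `D₁`-diagrams `X` for which `colim^u X`
exists, i.e. for which the functor `Y ↦ Hom(X, u^* Y)` on `M^{D₂}` is corepresentable. -/
abbrev ColimDomain := (res M u).PartialLeftAdjointSource

/-- The inclusion `M^{D₁}_{colim^u} ⥤ M^{D₁}`. -/
abbrev iColim : ColimDomain M u ⥤ (D₁ ⥤ M) := (res M u).leftAdjointObjIsDefined.ι

/-- The functor `colim^u : M^{D₁}_{colim^u} ⥤ M^{D₂}`: the partial left adjoint of `u^*`. -/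
abbrev colimAlong : ColimDomain M u ⥤ (D₂ ⥤ M) := (res M u).partialLeftAdjoint

/-- The full subcategory `M^{D₁}_{lim^u}` of those `D₁`-diagrams `X` for which `lim^u X`
exists, i.e. for which the functor `Y ↦ Hom(u^* Y, X)` on `M^{D₂}` is representable. -/
abbrev LimDomain := (res M u).PartialRightAdjointSource

/-- The inclusion `M^{D₁}_{lim^u} ⥤ M^{D₁}`. -/
abbrev iLim : LimDomain M u ⥤ (D₁ ⥤ M) := (res M u).rightAdjointObjIsDefined.ι

/-- The functor `lim^u : M^{D₁}_{lim^u} ⥤ M^{D₂}`: the partial right adjoint of `u^*`. -/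
abbrev limAlong : LimDomain M u ⥤ (D₂ ⥤ M) := (res M u).partialRightAdjoint

variable {M}

/-- The universal map `X ⟶ u^* (colim^u X)`. -/
def colimUnit (X : ColimDomain M u) :
    (iColim M u).obj X ⟶ (res M u).obj ((colimAlong M u).obj X) :=
  (res M u).partialLeftAdjointHomEquiv (𝟙 _)

/-- The universal map `u^* (lim^u X) ⟶ X`. -/
def limCounit (X : LimDomain M u) :
    (res M u).obj ((limAlong M u).obj X) ⟶ (iLim M u).obj X :=
  (res M u).partialRightAdjointHomEquiv (𝟙 _)

/-- `(L, ε)` is the homotopy colimit of `u`, i.e. the left derived functor of `colim^u`: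
`ε : L ∘ (γ_{D₁} ∘ i) ⟶ γ_{D₂} ∘ colim^u` is terminal among all such pairs. Such pairs are
called left Kan extensions in the literature on derived functors
and *right* Kan extensions in Mathlib. -/
def IsHomotopyColimit (L : Ho W D₁ ⥤ Ho W D₂)
    (ε : (iColim M u ⋙ γ W D₁) ⋙ L ⟶ colimAlong M u ⋙ γ W D₂) : Prop :=
  L.IsRightKanExtension ε

/-- `(R, ν)` is the homotopy limit of `u`, i.e. the right derived functor of `lim^u`:
`ν : γ_{D₂} ∘ lim^u ⟶ R ∘ (γ_{D₁} ∘ i)` is initial among all such pairs. Such pairs are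
called right Kan extensions in the literature on derived functors
and *left* Kan extensions in Mathlib. -/
def IsHomotopyLimit (R : Ho W D₁ ⥤ Ho W D₂)
    (ν : limAlong M u ⋙ γ W D₂ ⟶ (iLim M u ⋙ γ W D₁) ⋙ R) : Prop :=
  R.IsLeftKanExtension ν

end

end ABC

/-!
# Existence of homotopy colimits and limits

In a cofibration category a *free cell* at `d : D` on a cofibration `A ⟶ B` is glued to a diagram
`Z : D ⥤ M` by a pointwise pushout with one copy of `A ⟶ B` for each map out of `d`. *Cellular*
diagrams are built from the initial diagram by countably many such gluings. Factoring `X ⟶ Y` at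
all objects at once, gluing in the resulting cells and iterating countably often yields a cellular
replacement of every diagram: the values of the iterates are interleaved with the objects of the
factorizations. Relative cell complexes lift against pointwise weak equivalences up to
a trivial relative cell complex, so these replacements are unique up to homotopy, and inverting
the weak equivalences on cellular diagrams alone already gives the homotopy category of all
diagrams.

A free cell at `d` corepresents the same functor on `E`-diagrams, restricted along `F : D ⥤ E`, as
a free cell at `F.obj d`. Hence `colim^F` is defined on cellular diagrams and takes trivial relative
cell complexes to trivial relative cell complexes. It therefore inverts weak equivalences between
cellular diagrams and has a left derived functor, which is left adjoint to `hoRes W F` since a map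
from a cellular diagram to a restriction transposes to a map out of `colim^F`. The universal
property of the derived functor is tested on cellular diagrams, where `ε` is invertible.

Homotopy limits in `M` are homotopy colimits in the cofibration category `Mᵒᵖ`.
-/

namespace ABC

/-! ### Resolving classes -/

section Resolving

variable {C : Type*} [Category* C] {H : Type*} [Category* H]

/-- A class of objects `K` is resolving for the weak equivalences `W` if every object admits a weak
equivalence from an object of `K`, and if these resolutions are unique up to homotopy, in the
sense that maps into the target of a resolution can be dominated by a further resolution. -/
structure IsResolving (W : MorphismProperty C) (K : ObjectProperty C) : Prop where
  exists_resolution : ∀ X : C, ∃ (P : C) (q : P ⟶ X), K P ∧ W q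
  exists_cospan : ∀ {P P' X : C} (a : P ⟶ X) (b : P' ⟶ X), K P → K P' → W b →
    ∃ (Z : C) (i : P ⟶ Z) (j : P' ⟶ Z) (r : Z ⟶ X), K Z ∧ W r ∧ i ≫ r = a ∧ j ≫ r = b
  exists_cylinder : ∀ {P Z Y : C} (a b : P ⟶ Z) (r : Z ⟶ Y), K P → K Z → W r → a ≫ r = b ≫ r →
    ∃ (I Z' : C) (i₀ i₁ : P ⟶ I) (s : I ⟶ P) (z : Z ⟶ Z') (c : I ⟶ Z'),
      K I ∧ K Z' ∧ W s ∧ W z ∧ i₀ ≫ s = 𝟙 P ∧ i₁ ≫ s = 𝟙 P ∧ i₀ ≫ c = a ≫ z ∧ i₁ ≫ c = b ≫ z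

namespace IsResolving

variable {W : MorphismProperty C} {K : ObjectProperty C} (hK : IsResolving W K)

include hK

lemma map_eq_map_of_comp_eq {T : K.FullSubcategory ⥤ H} (hT : (W.inverseImage K.ι).IsInvertedBy T)
    {P Z : K.FullSubcategory} {Y : C} (a b : P ⟶ Z) (r : Z.obj ⟶ Y) (hr : W r)
    (h : a.hom ≫ r = b.hom ≫ r) : T.map a = T.map b := by
  obtain ⟨I, Z', i₀, i₁, s, z, c, hI, hZ', hs, hz, h₀, h₁, h₀', h₁'⟩ :=
    hK.exists_cylinder a.hom b.hom r P.property Z.property hr h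
  let I' : K.FullSubcategory := ⟨I, hI⟩
  let i₀' : P ⟶ I' := K.homMk i₀
  let i₁' : P ⟶ I' := K.homMk i₁
  let s' : I' ⟶ P := K.homMk s
  let z' : Z ⟶ ⟨Z', hZ'⟩ := K.homMk z
  let c' : I' ⟶ ⟨Z', hZ'⟩ := K.homMk c
  have := hT s' hs
  have := hT z' hz
  have ends_eq : T.map i₀' = T.map i₁' := by
    rw [← cancel_mono (T.map s'), ← T.map_comp, ← T.map_comp,
      show i₀' ≫ s' = i₁' ≫ s' by ext; exact h₀.trans h₁.symm]
  rw [← cancel_mono (T.map z'), ← T.map_comp, ← T.map_comp,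
    show a ≫ z' = i₀' ≫ c' by ext; exact h₀'.symm,
    show b ≫ z' = i₁' ≫ c' by ext; exact h₁'.symm, T.map_comp, T.map_comp, ends_eq]

lemma exists_costructuredArrow_cospan {X : C} (a b : CostructuredArrow K.ι X) (hb : W b.hom) :
    ∃ (Z : CostructuredArrow K.ι X) (_ : a ⟶ Z) (_ : b ⟶ Z), W Z.hom := by
  obtain ⟨Z, i, j, r, hZ, hr, hi, hj⟩ :=
    hK.exists_cospan a.hom b.hom a.left.property b.left.property hb
  exact ⟨CostructuredArrow.mk (Y := (⟨Z, hZ⟩ : K.FullSubcategory)) r,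
    CostructuredArrow.homMk (K.homMk i) hi, CostructuredArrow.homMk (K.homMk j) hj, hr⟩

variable [W.HasTwoOutOfThreeProperty]

omit hK in
lemma isIso_proj_comp_map {T : K.FullSubcategory ⥤ H}
    (hT : (W.inverseImage K.ι).IsInvertedBy T) {X : C} {a b : CostructuredArrow K.ι X} (f : a ⟶ b)
    (ha : W a.hom) (hb : W b.hom) : IsIso ((CostructuredArrow.proj K.ι X ⋙ T).map f) :=
  hT f.left (W.of_postcomp (K.ι.map f.left) b.hom hb (by rwa [CostructuredArrow.w f]))

/-- The legs of the colimit cocone: dominate both objects by a third resolution. -/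
lemma exists_proj_comp_map_eq_comp {T : K.FullSubcategory ⥤ H}
    (hT : (W.inverseImage K.ι).IsInvertedBy T) {X : C} (a q : CostructuredArrow K.ι X)
    (hq : W q.hom) :
    ∃ m : (CostructuredArrow.proj K.ι X ⋙ T).obj a ⟶ (CostructuredArrow.proj K.ι X ⋙ T).obj q,
      ∀ (Z : CostructuredArrow K.ι X) (i : a ⟶ Z) (j : q ⟶ Z), W Z.hom →
        (CostructuredArrow.proj K.ι X ⋙ T).map i =
          m ≫ (CostructuredArrow.proj K.ι X ⋙ T).map j := by
  obtain ⟨Z₁, i₁, j₁, hZ₁⟩ := hK.exists_costructuredArrow_cospan a q hq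
  let S := CostructuredArrow.proj K.ι X ⋙ T
  have : IsIso (S.map j₁) := isIso_proj_comp_map hT j₁ hq hZ₁
  refine ⟨S.map i₁ ≫ inv (S.map j₁), fun Z i j hZ => ?_⟩
  obtain ⟨Z₂, k, k₁, hZ₂⟩ := hK.exists_costructuredArrow_cospan Z Z₁ hZ₁
  have : IsIso (S.map k) := isIso_proj_comp_map hT k hZ hZ₂
  have parallel {b : CostructuredArrow K.ι X} (f g : b ⟶ Z₂) : S.map f = S.map g :=
    hK.map_eq_map_of_comp_eq hT _ _ Z₂.hom hZ₂
      ((CostructuredArrow.w f).trans (CostructuredArrow.w g).symm)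
  have hi : S.map i ≫ S.map k = S.map i₁ ≫ S.map k₁ := by
    rw [← S.map_comp, ← S.map_comp]; exact parallel _ _
  have hj : S.map j ≫ S.map k = S.map j₁ ≫ S.map k₁ := by
    rw [← S.map_comp, ← S.map_comp]; exact parallel _ _
  change S.map i = _ ≫ S.map j
  rw [← cancel_mono (S.map k), Category.assoc, Category.assoc, hi, hj, IsIso.inv_hom_id_assoc]

lemma exists_isColimit_isIso {T : K.FullSubcategory ⥤ H}
    (hT : (W.inverseImage K.ι).IsInvertedBy T) {X : C} (q : CostructuredArrow K.ι X)
    (hq : W q.hom) :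
    ∃ c : Cocone (CostructuredArrow.proj K.ι X ⋙ T), Nonempty (IsColimit c) ∧
      IsIso (c.ι.app q) := by
  let S := CostructuredArrow.proj K.ι X ⋙ T
  have legs (a : CostructuredArrow K.ι X) : ∃ m : S.obj a ⟶ S.obj q,
      ∀ (Z : CostructuredArrow K.ι X) (i : a ⟶ Z) (j : q ⟶ Z), W Z.hom →
        S.map i = m ≫ S.map j := hK.exists_proj_comp_map_eq_comp hT a q hq
  choose m hm using legs
  have hmq : m q = 𝟙 (S.obj q) := by
    simpa only [S.map_id, Category.comp_id] using (hm q q (𝟙 q) (𝟙 q) hq).symm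
  let c : Cocone S :=
    { pt := S.obj q
      ι := { app := m
             naturality := fun a b f => by
              obtain ⟨Z, i, j, hZ⟩ := hK.exists_costructuredArrow_cospan b q hq
              have : IsIso (S.map j) := isIso_proj_comp_map hT j hq hZ
              rw [← cancel_mono (S.map j), Category.assoc, ← hm b Z i j hZ, ← S.map_comp,
                hm a Z (f ≫ i) j hZ]
              simp } }
  refine ⟨c, ⟨{ desc s := s.ι.app q, fac s a := ?_, uniq s φ hφ := ?_ }⟩, ?_⟩
  · obtain ⟨Z, i, j, hZ⟩ := hK.exists_costructuredArrow_cospan a q hq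
    change m a ≫ s.ι.app q = s.ι.app a
    rw [← s.w i, ← s.w j, ← Category.assoc]
    exact congrArg (· ≫ s.ι.app Z) (hm a Z i j hZ).symm
  · exact (Category.id_comp φ).symm.trans ((congrArg (· ≫ φ) hmq.symm).trans (hφ q))
  · change IsIso (m q)
    rw [hmq]
    infer_instance

lemma isIso_ι_app {T : K.FullSubcategory ⥤ H} (hT : (W.inverseImage K.ι).IsInvertedBy T) {X : C}
    {c : Cocone (CostructuredArrow.proj K.ι X ⋙ T)} (hc : IsColimit c)
    (q : CostructuredArrow K.ι X) (hq : W q.hom) : IsIso (c.ι.app q) := by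
  obtain ⟨c', ⟨hc'⟩, _⟩ := hK.exists_isColimit_isIso hT q hq
  rw [← IsColimit.comp_coconePointUniqueUpToIso_hom hc' hc q]
  infer_instance

lemma nonempty_isColimit {T : K.FullSubcategory ⥤ H} (hT : (W.inverseImage K.ι).IsInvertedBy T)
    {X : C} (c : Cocone (CostructuredArrow.proj K.ι X ⋙ T)) (q : CostructuredArrow K.ι X)
    (hq : W q.hom) [IsIso (c.ι.app q)] : Nonempty (IsColimit c) := by
  obtain ⟨c', ⟨hc'⟩, _⟩ := hK.exists_isColimit_isIso hT q hq
  have : IsIso (c'.ι.app q ≫ hc'.desc c) := by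
    rw [hc'.fac]
    infer_instance
  have : IsIso (hc'.desc c) := IsIso.of_isIso_comp_left (c'.ι.app q) _
  exact ⟨hc'.ofPointIso⟩

lemma hasPointwiseLeftKanExtension {T : K.FullSubcategory ⥤ H}
    (hT : (W.inverseImage K.ι).IsInvertedBy T) : K.ι.HasPointwiseLeftKanExtension T := fun X => by
  obtain ⟨P, q, hP, hq⟩ := hK.exists_resolution X
  obtain ⟨c, ⟨hc⟩, -⟩ := hK.exists_isColimit_isIso hT
    (CostructuredArrow.mk (Y := (⟨P, hP⟩ : K.FullSubcategory)) q) hq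
  exact ⟨⟨⟨c, hc⟩⟩⟩

lemma isInvertedBy_right {T : K.FullSubcategory ⥤ H} (hT : (W.inverseImage K.ι).IsInvertedBy T)
    {E : K.ι.LeftExtension T} (hE : E.IsPointwiseLeftKanExtension) : W.IsInvertedBy E.right := by
  intro X Y f hf
  obtain ⟨P, q, hP, hq⟩ := hK.exists_resolution X
  let P' : K.FullSubcategory := ⟨P, hP⟩
  have h₁ : IsIso (E.hom.app P' ≫ E.right.map q) :=
    hK.isIso_ι_app hT (hE X) (CostructuredArrow.mk (Y := P') q) hq
  have h₂ : IsIso (E.hom.app P' ≫ E.right.map (q ≫ f)) :=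
    hK.isIso_ι_app hT (hE Y) (CostructuredArrow.mk (Y := P') (q ≫ f)) (W.comp_mem _ _ hq hf)
  rw [E.right.map_comp, ← Category.assoc] at h₂
  exact IsIso.of_isIso_comp_left (E.hom.app P' ≫ E.right.map q) _

lemma nonempty_isPointwiseLeftKanExtension {T : K.FullSubcategory ⥤ H} {A : C ⥤ H}
    (hA : W.IsInvertedBy A) (φ : T ≅ K.ι ⋙ A) :
    Nonempty (Functor.LeftExtension.mk A φ.hom).IsPointwiseLeftKanExtension := by
  have hT : (W.inverseImage K.ι).IsInvertedBy T := fun P P' f hf => by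
    have : IsIso ((K.ι ⋙ A).map f) := hA f.hom hf
    rw [NatIso.isIso_map_iff φ]
    exact this
  refine ⟨fun X => Nonempty.some ?_⟩
  obtain ⟨P, q, hP, hq⟩ := hK.exists_resolution X
  let P' : K.FullSubcategory := ⟨P, hP⟩
  let q' := CostructuredArrow.mk (S := K.ι) (Y := P') q
  have : IsIso (A.map q) := hA q hq
  have : IsIso (((Functor.LeftExtension.mk A φ.hom).coconeAt X).ι.app q') :=
    inferInstanceAs (IsIso (φ.hom.app P' ≫ A.map q))
  exact hK.nonempty_isColimit hT _ q' hq

lemma nonempty_iso_of_iso_comp {A B : C ⥤ H} (hA : W.IsInvertedBy A) (hB : W.IsInvertedBy B)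
    (φ : K.ι ⋙ A ≅ K.ι ⋙ B) : Nonempty (A ≅ B) := by
  obtain ⟨hA'⟩ := hK.nonempty_isPointwiseLeftKanExtension hA (Iso.refl _)
  obtain ⟨hB'⟩ := hK.nonempty_isPointwiseLeftKanExtension hB φ
  have : A.IsLeftKanExtension (Iso.refl (K.ι ⋙ A)).hom := hA'.isLeftKanExtension
  have : B.IsLeftKanExtension φ.hom := hB'.isLeftKanExtension
  exact ⟨A.leftKanExtensionUnique (Iso.refl (K.ι ⋙ A)).hom B φ.hom⟩

/-- The inverse of the comparison functor is induced by the left Kan extension of the localization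
functor of `K`. -/
theorem isLocalization_comp (Q : C ⥤ H) [Q.IsLocalization W] :
    (K.ι ⋙ Q).IsLocalization (W.inverseImage K.ι) := by
  let WK := W.inverseImage K.ι
  have hQ : WK.IsInvertedBy (K.ι ⋙ Q) := fun _ _ f hf => Localization.inverts Q W f.hom hf
  have hWK := Localization.inverts WK.Q WK
  have := hK.hasPointwiseLeftKanExtension hWK
  let R := K.ι.pointwiseLeftKanExtension WK.Q
  have hR : W.IsInvertedBy R :=
    hK.isInvertedBy_right hWK (K.ι.pointwiseLeftKanExtensionIsPointwiseLeftKanExtension WK.Q)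
  have := (K.ι.pointwiseLeftKanExtensionIsPointwiseLeftKanExtension WK.Q).isIso_hom
  let ρ : WK.Q ≅ K.ι ⋙ R := @asIso _ _ _ _ (K.ι.pointwiseLeftKanExtensionUnit WK.Q) this
  let Ψ : H ⥤ WK.Localization := Localization.lift R hR Q
  let Φ : WK.Localization ⥤ H := Localization.lift (K.ι ⋙ Q) hQ WK.Q
  let φ : WK.Q ⋙ Φ ≅ K.ι ⋙ Q := Localization.fac _ hQ WK.Q
  let ψ : Q ⋙ Ψ ≅ R := Localization.fac R hR Q
  have hRΦ : W.IsInvertedBy (R ⋙ Φ) := fun X Y f hf => by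
    have := hR f hf
    exact inferInstanceAs (IsIso (Φ.map (R.map f)))
  obtain ⟨χ⟩ := hK.nonempty_iso_of_iso_comp hRΦ (Localization.inverts Q W)
    (Functor.isoWhiskerRight ρ.symm Φ ≪≫ φ)
  let ΨΦ : Ψ ⋙ Φ ≅ 𝟭 H := Localization.liftNatIso Q W (Q ⋙ Ψ ⋙ Φ) (Q ⋙ 𝟭 H) _ _
    (Functor.isoWhiskerRight ψ Φ ≪≫ χ)
  let ΦΨ : Φ ⋙ Ψ ≅ 𝟭 _ := Localization.liftNatIso WK.Q WK (WK.Q ⋙ Φ ⋙ Ψ) (WK.Q ⋙ 𝟭 _) _ _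
    (Functor.isoWhiskerRight φ Ψ ≪≫ Functor.isoWhiskerLeft K.ι ψ ≪≫ ρ.symm)
  exact Functor.IsLocalization.of_equivalence_target WK.Q WK _
    (CategoryTheory.Equivalence.mk Φ Ψ ΦΨ.symm ΨΦ) φ

end IsResolving

end Resolving

/-! ### Derived functors of partial adjoints -/

section DerivedAdjunction

section UniversalArrow

variable {C D : Type*} [Category* C] [Category* D]

/-- The map `g : X ⟶ G.obj V` is universal, i.e. `V` is the value at `X` of a partially defined left
adjoint of `G`. -/
def IsUniversalArrow (G : D ⥤ C) {X : C} {V : D} (g : X ⟶ G.obj V) : Prop :=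
  ∀ (Y : D) (x : X ⟶ G.obj Y), ∃! l : V ⟶ Y, g ≫ G.map l = x

namespace IsUniversalArrow

variable {G : D ⥤ C} {X : C} {V : D} {g : X ⟶ G.obj V}

lemma hom_ext (hg : IsUniversalArrow G g) {Y : D} {l l' : V ⟶ Y}
    (h : g ≫ G.map l = g ≫ G.map l') : l = l' :=
  (hg Y _).unique h rfl

lemma iso_comp (hg : IsUniversalArrow G g) {X' : C} (φ : X' ≅ X) :
    IsUniversalArrow G (φ.hom ≫ g) := fun Y x => by
  simpa only [Category.assoc, ← Iso.eq_inv_comp] using hg Y (φ.inv ≫ x)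

lemma isIso (hg : IsUniversalArrow G g) {V' : D} {g' : X ⟶ G.obj V'}
    (hg' : IsUniversalArrow G g') {l : V ⟶ V'} (hl : g ≫ G.map l = g') : IsIso l := by
  obtain ⟨l', hl', -⟩ := hg' V g
  exact ⟨l', hg.hom_ext (by simp [reassoc_of% hl, hl']),
    hg'.hom_ext (by simp [reassoc_of% hl', hl])⟩

lemma leftAdjointObjIsDefined (hg : IsUniversalArrow G g) : G.leftAdjointObjIsDefined X :=
  Functor.CorepresentableBy.isCorepresentable (X := V)
    { homEquiv {Y} := .ofBijective (fun l => g ≫ G.map l)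
        ⟨fun _ _ => hg.hom_ext, fun x => (hg Y x).exists⟩
      homEquiv_comp f l := by
        change g ≫ G.map (l ≫ f) = (g ≫ G.map l) ≫ G.map f
        rw [G.map_comp, Category.assoc] }

end IsUniversalArrow

end UniversalArrow

section RightKanExtension

variable {K₀ C₀ H₁ H₂ : Type*} [Category* K₀] [Category* C₀] [Category* H₁] [Category* H₂]

lemma isRightKanExtension_of_isLocalization_comp (k : K₀ ⥤ C₀) (p : C₀ ⥤ H₁)
    (WK : MorphismProperty K₀) [(k ⋙ p).IsLocalization WK]
    (hk : ∀ X : C₀, ∃ (P : K₀) (q : k.obj P ⟶ X), IsIso (p.map q))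
    {t : C₀ ⥤ H₂} (L : H₁ ⥤ H₂) (ε : p ⋙ L ⟶ t) [∀ P, IsIso (ε.app (k.obj P))] :
    L.IsRightKanExtension ε := by
  have : IsIso (Functor.whiskerLeft k ε) := (NatTrans.isIso_iff_isIso_app _).2 fun P =>
    inferInstanceAs (IsIso (ε.app (k.obj P)))
  have exists_lift (Λ : H₁ ⥤ H₂) (l : p ⋙ Λ ⟶ t) :
      ∃ δ : Λ ⟶ L, Functor.whiskerLeft p δ ≫ ε = l := by
    obtain ⟨δ, hδ⟩ := (Localization.full_whiskeringLeft (k ⋙ p) WK H₂).map_surjective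
      (X := Λ) (Y := L) (Functor.whiskerLeft k l ≫ inv (Functor.whiskerLeft k ε))
    have hδ' (P : K₀) : δ.app (p.obj (k.obj P)) ≫ ε.app (k.obj P) = l.app (k.obj P) :=
      NatTrans.congr_app ((IsIso.eq_comp_inv (Functor.whiskerLeft k ε)).1 hδ) P
    refine ⟨δ, NatTrans.ext (funext fun X => ?_)⟩
    obtain ⟨P, q, _⟩ := hk X
    have hl : Λ.map (p.map q) ≫ l.app X = l.app (k.obj P) ≫ t.map q := l.naturality q
    have hε : L.map (p.map q) ≫ ε.app X = ε.app (k.obj P) ≫ t.map q := ε.naturality q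
    change δ.app (p.obj X) ≫ ε.app X = l.app X
    rw [← cancel_epi (Λ.map (p.map q)), hl, δ.naturality_assoc, hε, ← Category.assoc, hδ']
  have lift_unique {Λ : H₁ ⥤ H₂} (δ δ' : Λ ⟶ L)
      (h : Functor.whiskerLeft p δ ≫ ε = Functor.whiskerLeft p δ' ≫ ε) : δ = δ' :=
    Localization.natTrans_ext (k ⋙ p) WK fun P =>
      (cancel_mono (ε.app (k.obj P))).1 (NatTrans.congr_app h (k.obj P))
  exact ⟨⟨IsTerminal.ofUniqueHom
    (fun E => CostructuredArrow.homMk _ (exists_lift E.left E.hom).choose_spec)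
    fun E f => by
      ext1
      exact lift_unique _ _
        ((CostructuredArrow.w f).trans (exists_lift E.left E.hom).choose_spec.symm)⟩⟩

end RightKanExtension

lemma isIso_of_unit_comp_map_eq {H₁ H₂ : Type*} [Category* H₁] [Category* H₂] {L : H₁ ⥤ H₂}
    {G' : H₂ ⥤ H₁} (adj : L ⊣ G') {A B : H₁} {V : H₂} (φ : V ≅ L.obj B) {y : B ⟶ G'.obj V}
    (hy : adj.unit.app B = y ≫ G'.map φ.hom) {κ : A ⟶ B} [IsIso κ] {f : L.obj A ⟶ V}
    (hf : adj.unit.app A ≫ G'.map f = κ ≫ y) : IsIso f := by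
  have hκ : κ ≫ adj.unit.app B = adj.unit.app A ≫ G'.map (L.map κ) := adj.unit.naturality κ
  have : f = L.map κ ≫ φ.inv := (adj.homEquiv _ _).injective <| by
    rw [adj.homEquiv_unit, adj.homEquiv_unit, hf, G'.map_comp, ← reassoc_of% hκ, hy,
      Category.assoc, ← G'.map_comp, φ.hom_inv_id, G'.map_id, Category.comp_id]
  exact this ▸ inferInstance

variable {C₁ C₂ H₁ H₂ : Type*} [Category* C₁] [Category* C₂] [Category* H₁] [Category* H₂]
  {W₁ : MorphismProperty C₁} [W₁.HasTwoOutOfThreeProperty] {K : ObjectProperty C₁}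
  (hK : IsResolving W₁ K) {Q₁ : C₁ ⥤ H₁} [Q₁.IsLocalization W₁] {Q₂ : C₂ ⥤ H₂} {G : C₂ ⥤ C₁}
  {G' : H₂ ⥤ H₁} (e : G ⋙ Q₁ ≅ Q₂ ⋙ G')

section Counit

variable {T : K.FullSubcategory ⥤ C₂} {η : K.ι ⟶ T ⋙ G} (hη : ∀ P, IsUniversalArrow G (η.app P))
  {L : H₁ ⥤ H₂} (φ : T ⋙ Q₂ ≅ K.ι ⋙ Q₁ ⋙ L)

include hK hη

/-- Since `Q₁ ⋙ L` is a pointwise left Kan extension along `K.ι`, a map out of `L (Q₁ (G Y))` is a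
compatible family indexed by the maps `P ⟶ G Y`, that is, by the maps `T P ⟶ Y`. -/
lemma exists_natTrans_comp_eq :
    ∃ c : G ⋙ Q₁ ⋙ L ⟶ Q₂, ∀ P, L.map (Q₁.map (η.app P)) ≫ c.app (T.obj P) = φ.inv.app P := by
  have hL : W₁.IsInvertedBy (Q₁ ⋙ L) := fun X Y f hf => by
    have := Localization.inverts Q₁ W₁ f hf
    exact inferInstanceAs (IsIso (L.map (Q₁.map f)))
  obtain ⟨hE⟩ := hK.nonempty_isPointwiseLeftKanExtension hL φ
  choose l hl using fun (P : K.FullSubcategory) (Y : C₂) (a : K.ι.obj P ⟶ G.obj Y) =>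
    (hη P Y a).exists
  have map_comp_l {P P' : K.FullSubcategory} (f : P ⟶ P') {Y : C₂} (a : K.ι.obj P' ⟶ G.obj Y) :
      T.map f ≫ l P' Y a = l P Y (K.ι.map f ≫ a) := (hη P).hom_ext <| by
    rw [hl, G.map_comp]
    exact (η.naturality_assoc f _).symm.trans (congrArg (K.ι.map f ≫ ·) (hl P' Y a))
  have l_comp {P : K.FullSubcategory} {Y Y' : C₂} (a : K.ι.obj P ⟶ G.obj Y) (f : Y ⟶ Y') :
      l P Y a ≫ f = l P Y' (a ≫ G.map f) := (hη P).hom_ext <| by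
    rw [hl, G.map_comp, ← Category.assoc, hl]
  let s (Y : C₂) : Cocone (CostructuredArrow.proj K.ι (G.obj Y) ⋙ T ⋙ Q₂) :=
    { pt := Q₂.obj Y
      ι := { app := fun a => Q₂.map (l a.left Y a.hom)
             naturality := fun a b f => (Q₂.map_comp _ _).symm.trans <|
              (congrArg Q₂.map ((map_comp_l f.left b.hom).trans
                (congrArg (l a.left Y) (CostructuredArrow.w f)))).trans
                  (Category.comp_id _).symm } }
  let c (Y : C₂) : L.obj (Q₁.obj (G.obj Y)) ⟶ Q₂.obj Y := (hE (G.obj Y)).desc (s Y)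
  have hc {P : K.FullSubcategory} {Y : C₂} (a : K.ι.obj P ⟶ G.obj Y) :
      φ.hom.app P ≫ L.map (Q₁.map a) ≫ c Y = Q₂.map (l P Y a) :=
    (Category.assoc _ _ _).symm.trans ((hE (G.obj Y)).fac (s Y) (CostructuredArrow.mk a))
  refine ⟨{ app := c, naturality := fun Y Y' f => (hE (G.obj Y)).hom_ext fun a => ?_ }, fun P => ?_⟩
  · change (φ.hom.app a.left ≫ L.map (Q₁.map a.hom)) ≫ L.map (Q₁.map (G.map f)) ≫ c Y' =
      (φ.hom.app a.left ≫ L.map (Q₁.map a.hom)) ≫ c Y ≫ Q₂.map f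
    rw [Category.assoc, ← L.map_comp_assoc, ← Q₁.map_comp, hc, Category.assoc,
      reassoc_of% hc a.hom, ← Q₂.map_comp, l_comp]
  · have l_η : l P _ (η.app P) = 𝟙 _ := (hη P).hom_ext ((hl _ _ _).trans (by simp))
    rw [← cancel_epi (φ.hom.app P), hc (η.app P), φ.hom_inv_id_app, l_η]
    exact Q₂.map_id _

include e in
lemma exists_counit (W₂ : MorphismProperty C₂) [Q₂.IsLocalization W₂] :
    ∃ counit : G' ⋙ L ⟶ 𝟭 H₂, ∀ P,
      L.map (Q₁.map (η.app P) ≫ e.hom.app (T.obj P)) ≫ counit.app (Q₂.obj (T.obj P)) =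
        φ.inv.app P := by
  obtain ⟨c, hc⟩ := exists_natTrans_comp_eq hK hη φ
  obtain ⟨counit, hcounit⟩ := (Localization.full_whiskeringLeft Q₂ W₂ H₂).map_surjective
    (X := G' ⋙ L) (Y := 𝟭 H₂) (Functor.whiskerRight e.inv L ≫ c)
  have counit_app (Y : C₂) : counit.app (Q₂.obj Y) = L.map (e.inv.app Y) ≫ c.app Y :=
    NatTrans.congr_app hcounit Y
  have map_e_comp_counit (Y : C₂) : L.map (e.hom.app Y) ≫ counit.app (Q₂.obj Y) = c.app Y := by
    rw [counit_app, ← L.map_comp_assoc, e.hom_inv_id_app, L.map_id, Category.id_comp]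
  exact ⟨counit, fun P => by rw [L.map_comp, Category.assoc, map_e_comp_counit, hc]⟩

omit [W₁.HasTwoOutOfThreeProperty] in
lemma whiskerLeft_unit_comp_whiskerRight_counit (W₂ : MorphismProperty C₂) [Q₂.IsLocalization W₂]
    {unit : 𝟭 H₁ ⟶ L ⋙ G'} {counit : G' ⋙ L ⟶ 𝟭 H₂}
    (unit_app : ∀ P : K.FullSubcategory, unit.app (Q₁.obj P.obj) =
      (Q₁.map (η.app P) ≫ e.hom.app (T.obj P)) ≫ G'.map (φ.hom.app P))
    (counit_app : ∀ P, L.map (Q₁.map (η.app P) ≫ e.hom.app (T.obj P)) ≫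
      counit.app (Q₂.obj (T.obj P)) = φ.inv.app P) :
    Functor.whiskerLeft G' unit ≫ Functor.whiskerRight counit G' = 𝟙 G' := by
  refine Localization.natTrans_ext Q₂ W₂ fun Y => ?_
  change unit.app (G'.obj (Q₂.obj Y)) ≫ G'.map (counit.app (Q₂.obj Y)) = 𝟙 _
  obtain ⟨P, q, hP, hq⟩ := hK.exists_resolution (G.obj Y)
  obtain ⟨l, hl, -⟩ := hη ⟨P, hP⟩ Y q
  let a := Q₁.map (η.app ⟨P, hP⟩) ≫ e.hom.app (T.obj ⟨P, hP⟩)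
  have hqe : Q₁.map q ≫ e.hom.app Y = a ≫ G'.map (Q₂.map l) := by
    rw [← hl, Q₁.map_comp, Category.assoc, Category.assoc]
    exact congrArg _ (e.hom.naturality l)
  have := Localization.inverts Q₁ W₁ q hq
  have : IsIso (a ≫ G'.map (Q₂.map l)) := hqe ▸ inferInstance
  have unit_naturality : (a ≫ G'.map (Q₂.map l)) ≫ unit.app (G'.obj (Q₂.obj Y)) =
    unit.app (Q₁.obj P) ≫ G'.map (L.map (a ≫ G'.map (Q₂.map l))) := unit.naturality _
  have counit_naturality : L.map (G'.map (Q₂.map l)) ≫ counit.app (Q₂.obj Y) =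
    counit.app _ ≫ Q₂.map l := counit.naturality (Q₂.map l)
  rw [← cancel_epi (a ≫ G'.map (Q₂.map l)), ← Category.assoc, unit_naturality, Category.assoc,
    ← G'.map_comp, L.map_comp, Category.assoc, counit_naturality, ← Category.assoc (L.map a),
    counit_app, unit_app ⟨P, hP⟩, Category.assoc, ← G'.map_comp, φ.hom_inv_id_app_assoc]
  exact (Category.comp_id _).symm

include e in
lemma exists_adjunction_unit_app_eq (W₂ : MorphismProperty C₂) [Q₂.IsLocalization W₂] :
    ∃ adj : L ⊣ G', ∀ P, adj.unit.app (Q₁.obj P.obj) =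
      (Q₁.map (η.app P) ≫ e.hom.app (T.obj P)) ≫ G'.map (φ.hom.app P) := by
  have := hK.isLocalization_comp Q₁
  obtain ⟨unit, hunit⟩ := (Localization.full_whiskeringLeft (K.ι ⋙ Q₁) (W₁.inverseImage K.ι)
    H₁).map_surjective (X := 𝟭 H₁) (Y := L ⋙ G')
    ((Functor.whiskerRight η Q₁ ≫ Functor.whiskerLeft T e.hom) ≫ Functor.whiskerRight φ.hom G')
  obtain ⟨counit, counit_app⟩ := exists_counit hK e hη φ W₂
  have unit_app (P : K.FullSubcategory) : unit.app (Q₁.obj P.obj) =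
      (Q₁.map (η.app P) ≫ e.hom.app (T.obj P)) ≫ G'.map (φ.hom.app P) :=
    NatTrans.congr_app hunit P
  have left_triangle : Functor.whiskerRight unit L ≫ Functor.whiskerLeft L counit = 𝟙 L := by
    refine Localization.natTrans_ext (K.ι ⋙ Q₁) (W₁.inverseImage K.ι) fun P => ?_
    change L.map (unit.app (Q₁.obj P.obj)) ≫ counit.app (L.obj (Q₁.obj P.obj)) = 𝟙 _
    have hφ : L.map (G'.map (φ.hom.app P)) ≫ counit.app (L.obj (Q₁.obj P.obj)) =
      counit.app (Q₂.obj (T.obj P)) ≫ φ.hom.app P := counit.naturality (φ.hom.app P)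
    rw [unit_app, L.map_comp, Category.assoc, hφ, ← Category.assoc, counit_app]
    exact φ.inv_hom_id_app P
  have right_triangle :=
    whiskerLeft_unit_comp_whiskerRight_counit hK e hη φ W₂ unit_app counit_app
  exact ⟨{ unit, counit,
           left_triangle_components := NatTrans.congr_app left_triangle,
           right_triangle_components := NatTrans.congr_app right_triangle }, unit_app⟩

end Counit

section DerivedFunctor

variable {C₀ : Type*} [Category* C₀] {i : C₀ ⥤ C₁} {T : C₀ ⥤ C₂} {η : i ⟶ T ⋙ G}

include hK in
theorem exists_isRightKanExtension_adjunction [i.Full] (k : K.FullSubcategory ⥤ C₀)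
    (κ : k ⋙ i ≅ K.ι) (W₂ : MorphismProperty C₂) [Q₂.IsLocalization W₂]
    (hη : ∀ P, IsUniversalArrow G (η.app (k.obj P)))
    (hT : (W₁.inverseImage K.ι).IsInvertedBy (k ⋙ T ⋙ Q₂)) :
    ∃ (L : H₁ ⥤ H₂) (ε : (i ⋙ Q₁) ⋙ L ⟶ T ⋙ Q₂) (adj : L ⊣ G'), L.IsRightKanExtension ε ∧
      ∀ X : C₀, adj.unit.app (Q₁.obj (i.obj X)) ≫ G'.map (ε.app X) =
        Q₁.map (η.app X) ≫ e.hom.app (T.obj X) := by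
  have := hK.isLocalization_comp Q₁
  have : (k ⋙ i ⋙ Q₁).IsLocalization (W₁.inverseImage K.ι) :=
    Functor.IsLocalization.of_iso _ (Functor.isoWhiskerRight κ.symm Q₁)
  let L : H₁ ⥤ H₂ := Localization.lift (k ⋙ T ⋙ Q₂) hT (k ⋙ i ⋙ Q₁)
  let φ : (k ⋙ T) ⋙ Q₂ ≅ K.ι ⋙ Q₁ ⋙ L :=
    (Localization.fac (k ⋙ T ⋙ Q₂) hT (k ⋙ i ⋙ Q₁)).symm ≪≫
      Functor.isoWhiskerRight κ (Q₁ ⋙ L)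
  obtain ⟨adj, hadj⟩ := exists_adjunction_unit_app_eq hK e
    (T := k ⋙ T) (η := κ.inv ≫ Functor.whiskerLeft k η)
    (fun P => (hη P).iso_comp (κ.symm.app P)) φ W₂
  let ε : (i ⋙ Q₁) ⋙ L ⟶ T ⋙ Q₂ :=
    Functor.whiskerRight (Functor.whiskerRight η Q₁ ≫ Functor.whiskerLeft T e.hom) L ≫
      Functor.whiskerLeft (T ⋙ Q₂) adj.counit
  have unit_comp_ε (X : C₀) : adj.unit.app (Q₁.obj (i.obj X)) ≫ G'.map (ε.app X) =
      Q₁.map (η.app X) ≫ e.hom.app (T.obj X) :=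
    (adj.homEquiv_unit _ _ _).symm.trans
      ((congrArg _ (adj.homEquiv_counit _ _ _).symm).trans (Equiv.apply_symm_apply _ _))
  have (P : K.FullSubcategory) : IsIso (ε.app (k.obj P)) := by
    refine isIso_of_unit_comp_map_eq adj (φ.app P) (hadj P) (κ := Q₁.map (κ.hom.app P)) <|
      (unit_comp_ε (k.obj P)).trans ?_
    have hκ : κ.hom.app P ≫ (κ.inv ≫ Functor.whiskerLeft k η).app P = η.app (k.obj P) :=
      κ.hom_inv_id_app_assoc P _
    rw [← Q₁.map_comp_assoc, hκ]
    rfl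
  refine ⟨L, ε, adj, isRightKanExtension_of_isLocalization_comp k (i ⋙ Q₁) (W₁.inverseImage K.ι)
    (fun X => ?_) L ε, unit_comp_ε⟩
  obtain ⟨P, q, hP, hq⟩ := hK.exists_resolution (i.obj X)
  obtain ⟨g, hg⟩ := i.map_surjective (κ.hom.app ⟨P, hP⟩ ≫ q)
  have := Localization.inverts Q₁ W₁ q hq
  refine ⟨⟨P, hP⟩, g, ?_⟩
  rw [Functor.comp_map, hg, Q₁.map_comp]
  infer_instance

end DerivedFunctor

end DerivedAdjunction

/-! ### Gluing cells -/

section PushoutAlong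

variable {C₁ C₂ C₃ : Type*} [Category* C₁] [Category* C₂] [Category* C₃]

/-- A pushout along a functor `G`: the map `j : V ⟶ V'` is obtained from `V` by gluing in `B` along
`f : A ⟶ B` and the attaching map `g : A ⟶ G.obj V`. If `G` has a left adjoint `L`, this says that
`j` is a pushout of `L.map f`; the point of the notion is that it does not require the existence of
`L`. -/
structure IsPushoutAlong (G : C₂ ⥤ C₁) {A B : C₁} {V V' : C₂} (f : A ⟶ B) (g : A ⟶ G.obj V)
    (j : V ⟶ V') (g' : B ⟶ G.obj V') : Prop where
  w : f ≫ g' = g ≫ G.map j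
  exists_desc {Y : C₂} (b : B ⟶ G.obj Y) (y : V ⟶ Y) (h : f ≫ b = g ≫ G.map y) :
    ∃ l : V' ⟶ Y, g' ≫ G.map l = b ∧ j ≫ l = y
  hom_ext {Y : C₂} {l l' : V' ⟶ Y} (hg : g' ≫ G.map l = g' ≫ G.map l') (hj : j ≫ l = j ≫ l') :
    l = l'

namespace IsPushoutAlong

variable {G : C₂ ⥤ C₁} {A B : C₁} {V V' : C₂} {f : A ⟶ B} {g : A ⟶ G.obj V} {j : V ⟶ V'}
  {g' : B ⟶ G.obj V'}

lemma comp (h : IsPushoutAlong G f g j g') {B' : C₁} {V'' : C₂} {f' : B ⟶ B'} {j' : V' ⟶ V''}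
    {g'' : B' ⟶ G.obj V''} (h' : IsPushoutAlong G f' g' j' g'') :
    IsPushoutAlong G (f ≫ f') g (j ≫ j') g'' where
  w := by rw [Category.assoc, h'.w, ← Category.assoc, h.w, G.map_comp, Category.assoc]
  exists_desc b y hy := by
    obtain ⟨l, hl, rfl⟩ := h.exists_desc (f' ≫ b) y (by rw [← hy, Category.assoc])
    obtain ⟨l', hl', rfl⟩ := h'.exists_desc b l hl.symm
    exact ⟨l', hl', Category.assoc _ _ _⟩
  hom_ext {Y l l'} hg hj := h'.hom_ext hg <| h.hom_ext
    (by rw [G.map_comp, G.map_comp, ← Category.assoc, ← Category.assoc, ← h'.w, Category.assoc, hg,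
      Category.assoc])
    (by rw [← Category.assoc, hj, Category.assoc])

lemma exists_of_comp {G₂ : C₃ ⥤ C₂} {U U' : C₃} {k : V ⟶ G₂.obj U} {t : U ⟶ U'}
    {m : B ⟶ (G₂ ⋙ G).obj U'} (h : IsPushoutAlong G f g j g')
    (h' : IsPushoutAlong (G₂ ⋙ G) f (g ≫ G.map k) t m) :
    ∃ k' : V' ⟶ G₂.obj U', IsPushoutAlong G₂ j k t k' := by
  obtain ⟨k', hm, hk'⟩ := h.exists_desc m (k ≫ G₂.map t)
    (h'.w.trans (by rw [G.map_comp, Category.assoc, Functor.comp_map]))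
  refine ⟨k', hk', fun b y hy => ?_, fun {Y l l'} hg hj => h'.hom_ext ?_ hj⟩
  · obtain ⟨l, hl, rfl⟩ := h'.exists_desc (g' ≫ G.map b) y (by
      rw [reassoc_of% h.w, ← G.map_comp, hy, G.map_comp, Category.assoc, Functor.comp_map])
    refine ⟨l, h.hom_ext ?_ ?_, rfl⟩
    · rw [G.map_comp, reassoc_of% hm]
      exact hl
    · rw [reassoc_of% hk', ← G₂.map_comp, hy]
  · have (l : U' ⟶ Y) : m ≫ (G₂ ⋙ G).map l = g' ≫ G.map (k' ≫ G₂.map l) := by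
      rw [G.map_comp, reassoc_of% hm, Functor.comp_map]
    rw [this, this, hg]

lemma seq {A : ℕ ⥤ C₁} {V : ℕ ⥤ C₂} {g : A ⟶ V ⋙ G} {c : Cocone A} (hc : IsColimit c)
    {d : Cocone V} (hd : IsColimit d)
    (h : ∀ n : ℕ, IsPushoutAlong G (A.map (homOfLE n.le_succ)) (g.app n)
      (V.map (homOfLE n.le_succ)) (g.app (n + 1))) :
    IsPushoutAlong G (c.ι.app 0) (g.app 0) (d.ι.app 0) (hc.map (G.mapCocone d) g) where
  w := hc.ι_map _ _ _
  exists_desc {Y} b y hy := by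
    have step (n : ℕ) (l : {l : V.obj n ⟶ Y // g.app n ≫ G.map l = c.ι.app n ≫ b}) :
        ∃ l' : {l : V.obj (n + 1) ⟶ Y // g.app (n + 1) ≫ G.map l = c.ι.app (n + 1) ≫ b},
          V.map (homOfLE n.le_succ) ≫ l'.1 = l.1 := by
      obtain ⟨l', hl', hl⟩ := (h n).exists_desc (c.ι.app (n + 1) ≫ b) l.1 (by
        rw [c.w_assoc, l.2])
      exact ⟨⟨l', hl'⟩, hl⟩
    choose next map_comp_next using step
    let l (n : ℕ) : {l : V.obj n ⟶ Y // g.app n ≫ G.map l = c.ι.app n ≫ b} :=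
      Nat.rec ⟨y, hy.symm⟩ next n
    let s : Cocone V := ⟨Y, NatTrans.ofSequence (fun n => (l n).1) fun n =>
      (map_comp_next n (l n)).trans (Category.comp_id _).symm⟩
    refine ⟨hd.desc s, hc.hom_ext fun n => ?_, hd.fac s 0⟩
    rw [hc.ι_map_assoc, ← (l n).2]
    exact congrArg _ ((G.map_comp _ _).symm.trans (congrArg _ (hd.fac s n)))
  hom_ext {Y l l'} hg hj := hd.hom_ext fun n => by
    induction n with
    | zero => exact hj
    | succ n ih =>
      refine (h n).hom_ext ?_ (by rw [d.w_assoc, d.w_assoc, ih])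
      have (l : d.pt ⟶ Y) : g.app (n + 1) ≫ G.map (d.ι.app (n + 1) ≫ l) =
          c.ι.app (n + 1) ≫ hc.map (G.mapCocone d) g ≫ G.map l := by
        rw [hc.ι_map_assoc, G.map_comp]
        rfl
      rw [this, this, hg]

lemma isUniversalArrow (h : IsPushoutAlong G f g j g') (hg : IsUniversalArrow G g) :
    IsUniversalArrow G g' := fun Y b => by
  obtain ⟨y, hy, -⟩ := hg Y (f ≫ b)
  obtain ⟨l, hl, -⟩ := h.exists_desc b y hy.symm
  refine ⟨l, hl, fun l' hl' => h.hom_ext (hl'.trans hl.symm) (hg.hom_ext ?_)⟩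
  rw [G.map_comp, G.map_comp, reassoc_of% h.w.symm, reassoc_of% h.w.symm, hl, hl']

end IsPushoutAlong

lemma isUniversalArrow_of_isInitial {G : C₂ ⥤ C₁} {I : C₁} (hI : IsInitial I) {V : C₂}
    (hV : IsInitial V) (g : I ⟶ G.obj V) : IsUniversalArrow G g := fun Y _ =>
  ⟨hV.to Y, hI.hom_ext _ _, fun _ _ => hV.hom_ext _ _⟩

end PushoutAlong

section FamilyPushout

variable {M : Type u} [Category.{v} M] {I : Type*} {A B : I → M} {V V' : M} {f : ∀ i, A i ⟶ B i}
  {g : ∀ i, A i ⟶ V} {j : V ⟶ V'} {g' : ∀ i, B i ⟶ V'}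

/-- The map `j : V ⟶ V'` is obtained by gluing in the family of maps `f i : A i ⟶ B i` along the
attaching maps `g i : A i ⟶ V`. If the coproducts of `A` and `B` exist, then `j` is a pushout of
`∐ A ⟶ ∐ B`, see `isFamilyPushout_iff_isPushout`. -/
structure IsFamilyPushout (f : ∀ i, A i ⟶ B i) (g : ∀ i, A i ⟶ V) (j : V ⟶ V')
    (g' : ∀ i, B i ⟶ V') : Prop where
  w (i : I) : f i ≫ g' i = g i ≫ j
  exists_desc {Y : M} (b : ∀ i, B i ⟶ Y) (y : V ⟶ Y) (h : ∀ i, f i ≫ b i = g i ≫ y) :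
    ∃ l : V' ⟶ Y, (∀ i, g' i ≫ l = b i) ∧ j ≫ l = y
  hom_ext {Y : M} {l l' : V' ⟶ Y} (hg : ∀ i, g' i ≫ l = g' i ≫ l') (hj : j ≫ l = j ≫ l') : l = l'

lemma isFamilyPushout_iff_isPushout [HasCoproduct A] [HasCoproduct B] :
    IsFamilyPushout f g j g' ↔
      IsPushout (Limits.Sigma.map f) (Limits.Sigma.desc g) (Limits.Sigma.desc g') j := by
  refine ⟨fun h => ⟨⟨?_⟩, ⟨?_⟩⟩, fun h => ⟨fun i => ?_, fun b y hb => ?_, fun hg hj => ?_⟩⟩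
  · ext i
    simpa using h.w i
  · have key (s : PushoutCocone (Limits.Sigma.map f) (Limits.Sigma.desc g)) :=
      h.exists_desc (fun i => Sigma.ι B i ≫ s.inl) s.inr fun i => by
        simpa using Sigma.ι A i ≫= s.condition
    choose l hl hl' using key
    refine PushoutCocone.IsColimit.mk _ l (fun s => ?_) hl' fun s m hm hm' =>
      h.hom_ext (fun i => ?_) (hm'.trans (hl' s).symm)
    · ext i
      simpa using hl s i
    · simpa using (Sigma.ι B i ≫= hm).trans (hl s i).symm
  · simpa using Sigma.ι A i ≫= h.w
  · have w : Limits.Sigma.map f ≫ Limits.Sigma.desc b = Limits.Sigma.desc g ≫ y := by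
      ext i
      simpa using hb i
    exact ⟨h.desc _ _ w, fun i => by
      simpa only [Sigma.ι_desc_assoc, Sigma.ι_desc] using Sigma.ι B i ≫= h.inl_desc _ _ w,
      h.inr_desc _ _ w⟩
  · refine h.hom_ext ?_ hj
    ext i
    simpa using hg i

/-- As `g i₀` is an isomorphism, gluing in the member `i₀` alone turns `V` into `B i₀`; the other
members are glued to that. -/
lemma IsFamilyPushout.erase (h : IsFamilyPushout f g j g') (i₀ : I)
    (hg : IsIso (g i₀)) :
    IsFamilyPushout (fun i : {i // i ≠ i₀} => f i) (fun i => g i ≫ inv (g i₀) ≫ f i₀) (g' i₀)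
      (fun i => g' i) where
  w i := by simp [h.w]
  exists_desc {Y} b y hy := by
    classical
    let b' (i : I) : B i ⟶ Y := if hi : i = i₀ then eqToHom (congrArg B hi) ≫ y else b ⟨i, hi⟩
    have b'_i₀ : b' i₀ = y := (dif_pos rfl).trans (Category.id_comp y)
    have b'_ne (i : {i // i ≠ i₀}) : b' i = b i := dif_neg i.2
    obtain ⟨l, hl, -⟩ := h.exists_desc b' (inv (g i₀) ≫ f i₀ ≫ y) fun i => by
      by_cases hi : i = i₀
      · subst hi
        simp [b'_i₀]
      · simpa [b'_ne ⟨i, hi⟩] using hy ⟨i, hi⟩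
    exact ⟨l, fun i => (hl i).trans (b'_ne i), (hl i₀).trans b'_i₀⟩
  hom_ext {Y l l'} hg hj := by
    refine h.hom_ext (fun i => ?_) ?_
    · by_cases hi : i = i₀
      · subst hi
        exact hj
      · exact hg ⟨i, hi⟩
    · rw [← cancel_epi (g i₀), ← reassoc_of% (h.w i₀), ← reassoc_of% (h.w i₀), hj]

end FamilyPushout

namespace IsCofibrationCategory

variable {M : Type u} [Category.{v} M] {W Cof : MorphismProperty M}
  (h : IsCofibrationCategory.{w} W Cof)

include h

lemma isCofibrant_of_isInitial {I : M} (hI : IsInitial I) : IsCofibrant Cof I := by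
  obtain ⟨I₀, ⟨h₀⟩, hc⟩ := h.exists_initial
  exact ⟨I₀, h₀, h.cof_of_isIso _ (inferInstanceAs (IsIso (h₀.uniqueUpToIso hI).hom)) hc⟩

lemma isCofibrant_of_cof {A B : M} {f : A ⟶ B} (hA : IsCofibrant Cof A) (hf : Cof f) :
    IsCofibrant Cof B := by
  obtain ⟨I, hI, hc⟩ := hA
  exact ⟨I, hI, hI.hom_ext (hI.to A ≫ f) (hI.to B) ▸ h.cof_comp _ _ hc hf⟩

section Family

variable {I : Type w} {A B : I → M} {f : ∀ i, A i ⟶ B i} (hA : ∀ i, IsCofibrant Cof (A i))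
  (hf : ∀ i, Cof (f i)) {V : M} (hV : IsCofibrant Cof V) {g : ∀ i, A i ⟶ V}

include hA hf hV

variable (g) in
lemma exists_isFamilyPushout :
    ∃ (V' : M) (j : V ⟶ V') (g' : ∀ i, B i ⟶ V'),
      IsFamilyPushout f g j g' := by
  obtain ⟨_, _, hA', -, hf', -⟩ := h.coproduct A B f hA hf
  have := h.hasPushout _ (Limits.Sigma.desc g) hf' hA' hV
  refine ⟨_, pushout.inr (Limits.Sigma.map f) (Limits.Sigma.desc g),
    fun i => Sigma.ι B i ≫ pushout.inl _ _, isFamilyPushout_iff_isPushout.2 ?_⟩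
  convert IsPushout.of_hasPushout (Limits.Sigma.map f) (Limits.Sigma.desc g)
  ext i
  simp

variable {V' : M} {j : V ⟶ V'} {g' : ∀ i, B i ⟶ V'}
  (hj : IsFamilyPushout f g j g')

include hj

lemma cof_of_isFamilyPushout : Cof j := by
  obtain ⟨_, _, hA', -, hf', -⟩ := h.coproduct A B f hA hf
  exact h.cof_pushout _ _ _ _ hf' hA' hV (isFamilyPushout_iff_isPushout.1 hj)

lemma weq_of_isFamilyPushout (hW : ∀ i, W (f i)) : W j := by
  obtain ⟨_, _, hA', -, hf', hW'⟩ := h.coproduct A B f hA hf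
  exact h.weq_pushout _ _ _ _ hf' (hW' hW) hA' hV (isFamilyPushout_iff_isPushout.1 hj)

end Family

section Sequence

variable {A : ℕ ⥤ M} (h₀ : IsCofibrant Cof (A.obj 0))
  (hA : ∀ n : ℕ, Cof (A.map (homOfLE n.le_succ))) {c : Cocone A} (hc : IsColimit c)

include h₀ hA hc

lemma cof_ι_zero : Cof (c.ι.app 0) := by
  obtain ⟨_, hcof, -⟩ := h.sequence A h₀ hA
  rw [← colimit.comp_coconePointUniqueUpToIso_hom hc 0]
  exact h.cof_comp _ _ hcof (h.cof_of_isIso _ inferInstance (h.isCofibrant_of_cof h₀ hcof))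

lemma weq_ι_zero (hW : ∀ n : ℕ, W (A.map (homOfLE n.le_succ))) : W (c.ι.app 0) := by
  have := h.two_out_of_three
  obtain ⟨_, -, hweq⟩ := h.sequence A h₀ hA
  rw [← colimit.comp_coconePointUniqueUpToIso_hom hc 0]
  exact W.comp_mem _ _ (hweq hW) (h.weq_of_isIso _ inferInstance)

end Sequence

end IsCofibrationCategory

section CellAttachment

variable {M : Type u} [Category.{v} M] {D : Type*} [Category* D] {S : Type*} {d : S → D}
  {A B : S → M} {f : ∀ s, A s ⟶ B s} {Z Z' : D ⥤ M} {α : ∀ s, A s ⟶ Z.obj (d s)} {t : Z ⟶ Z'}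
  {β : ∀ s, B s ⟶ Z'.obj (d s)}

variable (M) in
/-- The functor `Z ↦ (Z.obj (d s))ₛ`. Pushouts along it glue free cells `A s × D(d s, -)` to a
diagram. -/
abbrev evalFamily (d : S → D) : (D ⥤ M) ⥤ (S → M) :=
  Functor.pi' fun s => (evaluation D M).obj (d s)

variable (f α t β) in
/-- The diagram `Z'` is obtained from `Z` by gluing in free cells at the objects `d s`, and this
gluing is computed pointwise: a cell at `d s` contributes to `Z'.obj e` one copy of `f s` for each
map `d s ⟶ e`. -/
def IsCellAttachment : Prop :=
  ∀ e, IsFamilyPushout (fun z : Σ s, (d s ⟶ e) => f z.1) (fun z => α z.1 ≫ Z.map z.2) (t.app e)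
    (fun z => β z.1 ≫ Z'.map z.2)

lemma IsCellAttachment.isPushoutAlong (h : IsCellAttachment f α t β) :
    IsPushoutAlong (evalFamily M d) f α t β where
  w := funext fun s => by
    have : f s ≫ β s = α s ≫ t.app (d s) := by simpa using (h (d s)).w ⟨s, 𝟙 _⟩
    exact this
  exists_desc {Y} (b : ∀ s, B s ⟶ Y.obj (d s)) y hy := by
    have w (s : S) : f s ≫ b s = α s ≫ y.app (d s) := congrFun hy s
    choose l hl hl' using fun e => (h e).exists_desc (fun z => b z.1 ≫ Y.map z.2) (y.app e)
      fun z => by simp [reassoc_of% (w z.1)]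
    refine ⟨⟨l, fun e e' x => (h e).hom_ext (fun z => ?_) ?_⟩, funext fun s => ?_,
      NatTrans.ext (funext hl')⟩
    · simpa [reassoc_of% (hl e z)] using hl e' ⟨z.1, z.2 ≫ x⟩
    · rw [← t.naturality_assoc, hl', reassoc_of% (hl' e), y.naturality]
    · have : β s ≫ l (d s) = b s := by simpa using hl (d s) ⟨s, 𝟙 _⟩
      exact this
  hom_ext {Y l l'} hg hj := by
    ext e
    refine (h e).hom_ext (fun z => ?_) (NatTrans.congr_app hj e)
    have : β z.1 ≫ l.app _ = β z.1 ≫ l'.app _ := congrFun hg z.1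
    simp [reassoc_of% this]

variable (f α) in
lemma exists_isCellAttachment
    (h : ∀ e, ∃ (V : M) (j : Z.obj e ⟶ V) (g' : ∀ s, (d s ⟶ e) → (B s ⟶ V)),
      IsFamilyPushout (fun z : Σ s, (d s ⟶ e) => f z.1) (fun z => α z.1 ≫ Z.map z.2) j
        (fun z => g' z.1 z.2)) :
    ∃ (Z' : D ⥤ M) (t : Z ⟶ Z') (β : ∀ s, B s ⟶ Z'.obj (d s)), IsCellAttachment f α t β := by
  choose V j g' hV using h
  have exists_map {e e' : D} (x : e ⟶ e') : ∃ l : V e ⟶ V e',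
      (∀ s (a : d s ⟶ e), g' e s a ≫ l = g' e' s (a ≫ x)) ∧ j e ≫ l = Z.map x ≫ j e' := by
    obtain ⟨l, hl, hl'⟩ := (hV e).exists_desc (fun z => g' e' z.1 (z.2 ≫ x)) (Z.map x ≫ j e')
      fun z => by simpa using (hV e').w ⟨z.1, z.2 ≫ x⟩
    exact ⟨l, fun s a => hl ⟨s, a⟩, hl'⟩
  choose map g'_map j_map using @exists_map
  let Z' : D ⥤ M :=
    { obj := V
      map := map
      map_id e := (hV e).hom_ext (fun z => by simp [g'_map]) (by simp [j_map])
      map_comp x y := (hV _).hom_ext (fun z => by simp [reassoc_of% (g'_map x), g'_map])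
        (by simp [reassoc_of% (j_map x), j_map]) }
  refine ⟨Z', ⟨j, fun e e' x => (j_map x).symm⟩, fun s => g' (d s) s (𝟙 _), fun e => ?_⟩
  convert hV e with z
  exact (g'_map z.2 z.1 (𝟙 _)).trans (by simp)

end CellAttachment

section Cell

variable {M : Type u} [Category.{v} M] {D E : Type w} [SmallCategory D] [SmallCategory E]

/-- The relative cell complexes of diagrams: countable compositions of maps obtained by gluing in a
small family of free cells on maps of `J` with cofibrant domain. -/
inductive Cell (Cof J : MorphismProperty M) : MorphismProperty (D ⥤ M)
  | attach {S : Type w} {d : S → D} {A B : S → M} {f : ∀ s, A s ⟶ B s} {Z Z' : D ⥤ M}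
      {α : ∀ s, A s ⟶ Z.obj (d s)} {t : Z ⟶ Z'} {β : ∀ s, B s ⟶ Z'.obj (d s)}
      (hA : ∀ s, IsCofibrant Cof (A s)) (hf : ∀ s, J (f s)) (ht : IsCellAttachment f α t β) :
      Cell Cof J t
  | comp {Z Z' Z'' : D ⥤ M} {t : Z ⟶ Z'} {t' : Z' ⟶ Z''} (ht : Cell Cof J t)
      (ht' : Cell Cof J t') : Cell Cof J (t ≫ t')
  | seq {A : ℕ ⥤ D ⥤ M} {c : Cocone A} (hc : IsColimit c)
      (hA : ∀ n : ℕ, Cell Cof J (A.map (homOfLE n.le_succ))) : Cell Cof J (c.ι.app 0)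

variable {W Cof J : MorphismProperty M}

lemma Cell.mono {J' : MorphismProperty M} (hJ : J ≤ J') {Z Z' : D ⥤ M} {t : Z ⟶ Z'}
    (ht : Cell Cof J t) : Cell Cof J' t := by
  induction ht with
  | attach hA hf ht => exact .attach hA (fun s => hJ _ (hf s)) ht
  | comp _ _ ht ht' => exact .comp ht ht'
  | seq hc _ hA => exact .seq hc hA

lemma Cell.of_isIso {Z Z' : D ⥤ M} (t : Z ⟶ Z') [IsIso t] : Cell Cof J t :=
  .attach (S := PEmpty) (d := PEmpty.elim) (A := PEmpty.elim) (B := PEmpty.elim)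
    (f := fun s => s.elim) (α := fun s => s.elim) (β := fun s => s.elim) (fun s => s.elim)
    (fun s => s.elim) fun e =>
      { w z := z.1.elim
        exists_desc _ y _ := ⟨inv (t.app e) ≫ y, fun z => z.1.elim, by simp⟩
        hom_ext _ hj := (cancel_epi (t.app e)).1 hj }

namespace IsCofibrationCategory

variable (h : IsCofibrationCategory.{w} W Cof)

include h

section Sequence

variable {A : ℕ ⥤ D ⥤ M} (h₀ : ∀ e, IsCofibrant Cof ((A.obj 0).obj e))
  (hA : ∀ (n : ℕ) (e : D), Cof ((A.map (homOfLE n.le_succ)).app e))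

include h₀ hA

lemma hasColimit_flip_obj (e : D) : HasColimit (A.flip.obj e) :=
  (h.sequence (A.flip.obj e) (h₀ e) fun n => hA n e).1

lemma hasColimit_functor : HasColimit A :=
  have := h.hasColimit_flip_obj h₀ hA
  inferInstance

lemma nonempty_isColimit_evaluation_mapCocone {c : Cocone A} (hc : IsColimit c) (e : D) :
    Nonempty (IsColimit (((evaluation D M).obj e).mapCocone c)) :=
  have := h.hasColimit_flip_obj h₀ hA
  ⟨isColimitOfPreserves _ hc⟩

end Sequence

lemma cof_app_and_weq_app_of_cell (hJ : J ≤ Cof) {Z Z' : D ⥤ M} {t : Z ⟶ Z'}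
    (ht : Cell Cof J t) (hZ : ∀ e, IsCofibrant Cof (Z.obj e)) (e : D) :
    Cof (t.app e) ∧ (J ≤ W → W (t.app e)) := by
  have := h.two_out_of_three
  induction ht generalizing e with
  | @attach S d A B f Z Z' α t β hA hf ht =>
    have hA' (z : Σ s, (d s ⟶ e)) := hA z.1
    have hf' (z : Σ s, (d s ⟶ e)) := hf z.1
    exact ⟨h.cof_of_isFamilyPushout hA' (fun z => hJ _ (hf' z)) (hZ e) (ht e), fun hW =>
      h.weq_of_isFamilyPushout hA' (fun z => hJ _ (hf' z)) (hZ e) (ht e) fun z => hW _ (hf' z)⟩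
  | comp _ _ ih ih' =>
    have ih' := ih' (fun e => h.isCofibrant_of_cof (hZ e) (ih hZ e).1) e
    exact ⟨h.cof_comp _ _ (ih hZ e).1 ih'.1, fun hW => W.comp_mem _ _ ((ih hZ e).2 hW) (ih'.2 hW)⟩
  | @seq A c hc _ ih =>
    have hA (n : ℕ) : ∀ e, IsCofibrant Cof ((A.obj n).obj e) := by
      induction n with
      | zero => exact hZ
      | succ n ihn => exact fun e => h.isCofibrant_of_cof (ihn e) (ih n ihn e).1
    obtain ⟨hce⟩ := h.nonempty_isColimit_evaluation_mapCocone hZ (fun n e => (ih n (hA n) e).1) hc e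
    exact ⟨h.cof_ι_zero (hZ e) (fun n => (ih n (hA n) e).1) hce,
      fun hW => h.weq_ι_zero (hZ e) (fun n => (ih n (hA n) e).1) hce fun n =>
        (ih n (hA n) e).2 hW⟩

lemma cof_app_of_cell (hJ : J ≤ Cof) {Z Z' : D ⥤ M} {t : Z ⟶ Z'} (ht : Cell Cof J t)
    (hZ : ∀ e, IsCofibrant Cof (Z.obj e)) (e : D) : Cof (t.app e) :=
  (h.cof_app_and_weq_app_of_cell hJ ht hZ e).1

lemma weq_app_of_cell {Z Z' : D ⥤ M} {t : Z ⟶ Z'} (ht : Cell Cof (Cof ⊓ W) t)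
    (hZ : ∀ e, IsCofibrant Cof (Z.obj e)) (e : D) : W (t.app e) :=
  (h.cof_app_and_weq_app_of_cell inf_le_left ht hZ e).2 inf_le_right

lemma isCofibrant_obj_of_cell (hJ : J ≤ Cof) {Z Z' : D ⥤ M} {t : Z ⟶ Z'} (ht : Cell Cof J t)
    (hZ : ∀ e, IsCofibrant Cof (Z.obj e)) (e : D) : IsCofibrant Cof (Z'.obj e) :=
  h.isCofibrant_of_cof (hZ e) (h.cof_app_of_cell hJ ht hZ e)

lemma exists_isCellAttachment {S : Type w} {d : S → D} {A B : S → M} {f : ∀ s, A s ⟶ B s}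
    {Z : D ⥤ M} (α : ∀ s, A s ⟶ Z.obj (d s)) (hA : ∀ s, IsCofibrant Cof (A s))
    (hf : ∀ s, Cof (f s)) (hZ : ∀ e, IsCofibrant Cof (Z.obj e)) :
    ∃ (Z' : D ⥤ M) (t : Z ⟶ Z') (β : ∀ s, B s ⟶ Z'.obj (d s)), IsCellAttachment f α t β :=
  ABC.exists_isCellAttachment f α fun e => by
    obtain ⟨V, j, g', hV⟩ := h.exists_isFamilyPushout (fun z : Σ s, (d s ⟶ e) => hA z.1)
      (fun z => hf z.1) (hZ e) fun z => α z.1 ≫ Z.map z.2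
    exact ⟨V, j, fun s a => g' ⟨s, a⟩, hV⟩

section Extension

variable (F : D ⥤ E)

lemma exists_isPushoutAlong_res_of_seq (hJ : J ≤ Cof) {A : ℕ ⥤ D ⥤ M} {c : Cocone A}
    (hc : IsColimit c)
    (hA : ∀ (n : ℕ) {V : E ⥤ M} (_ : ∀ e, IsCofibrant Cof (V.obj e))
      (g : A.obj n ⟶ (res M F).obj V), ∃ (V' : E ⥤ M) (j : V ⟶ V') (g' : _ ⟶ (res M F).obj V'),
        Cell Cof J j ∧ IsPushoutAlong (res M F) (A.map (homOfLE n.le_succ)) g j g')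
    {V : E ⥤ M} (hV : ∀ e, IsCofibrant Cof (V.obj e)) (g : A.obj 0 ⟶ (res M F).obj V) :
    ∃ (V' : E ⥤ M) (j : V ⟶ V') (g' : c.pt ⟶ (res M F).obj V'),
      Cell Cof J j ∧ IsPushoutAlong (res M F) (c.ι.app 0) g j g' := by
  let Stage (n : ℕ) := {p : Σ V : E ⥤ M, (A.obj n ⟶ (res M F).obj V) //
    ∀ e, IsCofibrant Cof (p.1.obj e)}
  have step (n : ℕ) (p : Stage n) : ∃ (q : Stage (n + 1)) (j : p.1.1 ⟶ q.1.1), Cell Cof J j ∧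
      IsPushoutAlong (res M F) (A.map (homOfLE n.le_succ)) p.1.2 j q.1.2 := by
    obtain ⟨V', j, g', hj, hg'⟩ := hA n p.2 p.1.2
    exact ⟨⟨⟨V', g'⟩, h.isCofibrant_obj_of_cell hJ hj p.2⟩, j, hj, hg'⟩
  choose next j hj hg using step
  let stage (n : ℕ) : Stage n := Nat.rec ⟨⟨V, g⟩, hV⟩ next n
  let V' : ℕ ⥤ E ⥤ M := Functor.ofSequence fun n => j n (stage n)
  have map_V' (n : ℕ) : V'.map (homOfLE n.le_succ) = j n (stage n) :=
    Functor.ofSequence_map_homOfLE_succ _ n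
  let g' : A ⟶ V' ⋙ res M F := NatTrans.ofSequence (fun n => (stage n).1.2) fun n =>
    (hg n (stage n)).w.trans (congrArg (_ ≫ (res M F).map ·) (map_V' n).symm)
  have hV' (n : ℕ) : Cell Cof J (V'.map (homOfLE n.le_succ)) := by
    rw [map_V']
    exact hj n (stage n)
  have := h.hasColimit_functor (A := V') hV fun n => h.cof_app_of_cell hJ (hV' n) (stage n).2
  refine ⟨_, _, _, .seq (colimit.isColimit V') hV',
    .seq (g := g') hc (colimit.isColimit V') fun n => ?_⟩
  rw [map_V']
  exact hg n (stage n)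

/-- A free cell at `d` becomes a free cell at `F.obj d`. -/
lemma exists_isPushoutAlong_res (hJ : J ≤ Cof) {A B : D ⥤ M} {f : A ⟶ B} (hf : Cell Cof J f)
    {V : E ⥤ M} (hV : ∀ e, IsCofibrant Cof (V.obj e)) (g : A ⟶ (res M F).obj V) :
    ∃ (V' : E ⥤ M) (j : V ⟶ V') (g' : B ⟶ (res M F).obj V'),
      Cell Cof J j ∧ IsPushoutAlong (res M F) f g j g' := by
  induction hf generalizing V with
  | @attach S d A B f Z Z' α t β hA hf ht =>
    obtain ⟨V', j, β', hj⟩ := h.exists_isCellAttachment (d := fun s => F.obj (d s))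
      (fun s => α s ≫ g.app (d s)) hA (fun s => hJ _ (hf s)) hV
    obtain ⟨g', hg'⟩ := ht.isPushoutAlong.exists_of_comp (G₂ := res M F) (k := g) hj.isPushoutAlong
    exact ⟨V', j, g', .attach hA hf hj, hg'⟩
  | comp _ _ ih ih' =>
    obtain ⟨V', j, g', hj, hg'⟩ := ih hV g
    obtain ⟨V'', j', g'', hj', hg''⟩ := ih' (h.isCofibrant_obj_of_cell hJ hj hV) g'
    exact ⟨V'', j ≫ j', g'', .comp hj hj', hg'.comp hg''⟩
  | seq hc _ ih => exact h.exists_isPushoutAlong_res_of_seq F hJ hc (fun n _ => ih n) hV g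

end Extension

end IsCofibrationCategory

end Cell

/-! ### Factorization and lifting -/

lemma exists_isColimit_of_interleaved {C : Type*} [Category* C] {X B : ℕ ⥤ C}
    (x : ∀ n, X.obj n ⟶ B.obj n) (y : ∀ n, B.obj n ⟶ X.obj (n + 1))
    (hxy : ∀ n : ℕ, x n ≫ y n = X.map (homOfLE n.le_succ))
    (hyx : ∀ n : ℕ, y n ≫ x (n + 1) = B.map (homOfLE n.le_succ)) {c : Cocone X}
    (hc : IsColimit c) :
    ∃ ι : B ⟶ (Functor.const ℕ).obj c.pt, (∀ n, ι.app n = y n ≫ c.ι.app (n + 1)) ∧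
      Nonempty (IsColimit (Cocone.mk c.pt ι)) := by
  let ι : B ⟶ (Functor.const ℕ).obj c.pt :=
    NatTrans.ofSequence (fun n => y n ≫ c.ι.app (n + 1)) fun n => by
      simp [← hyx, reassoc_of% hxy]
  have x_ι (n : ℕ) : x n ≫ ι.app n = c.ι.app n := by simp [ι, reassoc_of% hxy]
  let restrict (s : Cocone B) : Cocone X :=
    ⟨s.pt, NatTrans.ofSequence (fun n => x n ≫ s.ι.app n) fun n => by
      simp [← hxy, reassoc_of% hyx]⟩
  refine ⟨ι, fun _ => rfl, ⟨{ desc s := hc.desc (restrict s), fac s n := ?_, uniq s m hm := ?_ }⟩⟩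
  · have : c.ι.app (n + 1) ≫ hc.desc (restrict s) = x (n + 1) ≫ s.ι.app (n + 1) :=
      hc.fac (restrict s) (n + 1)
    simp [ι, this, reassoc_of% hyx]
  · refine hc.uniq (restrict s) m fun n => ?_
    rw [← x_ι, Category.assoc]
    exact congrArg _ (hm n)

namespace IsCofibrationCategory

variable {M : Type u} [Category.{v} M] {D : Type w} [SmallCategory D]
  {W Cof : MorphismProperty M} (h : IsCofibrationCategory.{w} W Cof)

include h

lemma weq_of_isColimit_of_interleaved {X : ℕ ⥤ M} (h₀ : IsCofibrant Cof (X.obj 0)) {c : Cocone X}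
    (hc : IsColimit c) {Y : M} {q : c.pt ⟶ Y}
    (hX : ∀ n : ℕ, ∃ (B : M) (x : X.obj n ⟶ B) (y : B ⟶ X.obj (n + 1)), Cof x ∧ Cof y ∧
      x ≫ y = X.map (homOfLE n.le_succ) ∧ W (y ≫ c.ι.app (n + 1) ≫ q)) : W q := by
  have := h.two_out_of_three
  choose B x y hx hy hxy hW using hX
  let B' : ℕ ⥤ M := Functor.ofSequence fun n => y n ≫ x (n + 1)
  have map_B' (n : ℕ) : B'.map (homOfLE n.le_succ) = y n ≫ x (n + 1) :=
    Functor.ofSequence_map_homOfLE_succ _ n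
  have weq_leg (n : ℕ) : W ((y n ≫ c.ι.app (n + 1)) ≫ q) := by simpa using hW n
  have weq_hop (n : ℕ) : W ((y n ≫ x (n + 1)) ≫ y (n + 1) ≫ c.ι.app (n + 1 + 1) ≫ q) := by
    rw [Category.assoc, reassoc_of% (hxy (n + 1)), c.w_assoc]
    exact hW n
  obtain ⟨ι, hι, ⟨hι'⟩⟩ := exists_isColimit_of_interleaved (B := B') x y hxy
    (fun n => (map_B' n).symm) hc
  have weq_ι : W (ι.app 0) := by
    refine h.weq_ι_zero (h.isCofibrant_of_cof h₀ (hx 0)) (fun n => ?_) hι' fun n => ?_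
    · rw [map_B']
      exact h.cof_comp _ _ (hy n) (hx (n + 1))
    · rw [map_B']
      refine W.of_postcomp _ (y (n + 1) ≫ c.ι.app (n + 1 + 1) ≫ q) (hW (n + 1)) ?_
      exact weq_hop n
  have weq_ι_q : W (ι.app 0 ≫ q) :=
    (congrArg (fun a : B 0 ⟶ c.pt => W (a ≫ q)) (hι 0)).mpr (weq_leg 0)
  exact W.of_precomp _ q weq_ι weq_ι_q

section Factorization

variable {X Y : D ⥤ M} (hX : ∀ e, IsCofibrant Cof (X.obj e)) (p : X ⟶ Y)

include hX

lemma exists_cell_interleaving :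
    ∃ (X' : D ⥤ M) (t : X ⟶ X') (p' : X' ⟶ Y), Cell Cof Cof t ∧ t ≫ p' = p ∧
      ∀ e, ∃ (B : M) (x : X.obj e ⟶ B) (y : B ⟶ X'.obj e), Cof x ∧ Cof y ∧ x ≫ y = t.app e ∧
        W (y ≫ p'.app e) := by
  choose B f r hf hr hfr using fun e => h.factorization (p.app e) (hX e)
  obtain ⟨X', t, β, ht⟩ := h.exists_isCellAttachment (d := id) (fun e => 𝟙 (X.obj e)) hX hf hX
  obtain ⟨p', hβp', htp'⟩ := ht.isPushoutAlong.exists_desc r p <| funext fun e =>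
    (hfr e).trans (Category.id_comp _).symm
  refine ⟨X', t, p', .attach hX hf ht, htp', fun e => ⟨B e, f e, β e, hf e, ?_, ?_, ?_⟩⟩
  · have : IsIso (𝟙 (X.obj e) ≫ X.map (𝟙 e)) := inferInstance
    simpa using h.cof_of_isFamilyPushout (I := {z : Σ s, (s ⟶ e) // z ≠ ⟨e, 𝟙 e⟩})
      (fun z => hX z.1.1) (fun z => hf z.1.1) (h.isCofibrant_of_cof (hX e) (hf e))
      ((ht e).erase ⟨e, 𝟙 e⟩ this)
  · simpa using (ht e).w ⟨e, 𝟙 e⟩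
  · rw [show β e ≫ p'.app e = r e from congrFun hβp' e]
    exact hr e

lemma exists_cell_factorization :
    ∃ (Z : D ⥤ M) (i : X ⟶ Z) (r : Z ⟶ Y), Cell Cof Cof i ∧ W.functorCategory D r ∧ i ≫ r = p := by
  let Stage := {q : Σ X : D ⥤ M, (X ⟶ Y) // ∀ e, IsCofibrant Cof (q.1.obj e)}
  have step (q : Stage) : ∃ (q' : Stage) (t : q.1.1 ⟶ q'.1.1), Cell Cof Cof t ∧
      t ≫ q'.1.2 = q.1.2 ∧ ∀ e, ∃ (B : M) (x : q.1.1.obj e ⟶ B) (y : B ⟶ q'.1.1.obj e),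
        Cof x ∧ Cof y ∧ x ≫ y = t.app e ∧ W (y ≫ q'.1.2.app e) := by
    obtain ⟨X', t, p', ht, htp', ht'⟩ := h.exists_cell_interleaving q.2 q.1.2
    exact ⟨⟨⟨X', p'⟩, h.isCofibrant_obj_of_cell le_rfl ht q.2⟩, t, ht, htp', ht'⟩
  choose next t ht htp ht' using step
  let stage (n : ℕ) : Stage := Nat.rec ⟨⟨X, p⟩, hX⟩ (fun _ => next) n
  let Z : ℕ ⥤ D ⥤ M := Functor.ofSequence fun n => t (stage n)
  have map_Z (n : ℕ) : Z.map (homOfLE n.le_succ) = t (stage n) :=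
    Functor.ofSequence_map_homOfLE_succ _ n
  have hZ (n : ℕ) : Cell Cof Cof (Z.map (homOfLE n.le_succ)) := by
    rw [map_Z]
    exact ht (stage n)
  have cof_Z (n : ℕ) := h.cof_app_of_cell le_rfl (hZ n) (stage n).2
  have := h.hasColimit_functor (A := Z) hX cof_Z
  let s : Cocone Z := ⟨Y, NatTrans.ofSequence (fun n => (stage n).1.2) fun n => by
    rw [map_Z]
    exact (htp (stage n)).trans (Category.comp_id _).symm⟩
  refine ⟨colimit Z, colimit.ι Z 0, colimit.desc Z s, .seq (colimit.isColimit Z) hZ, fun e => ?_,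
    colimit.ι_desc s 0⟩
  obtain ⟨hc⟩ := h.nonempty_isColimit_evaluation_mapCocone hX cof_Z (colimit.isColimit Z) e
  refine h.weq_of_isColimit_of_interleaved (hX e) hc fun n => ?_
  obtain ⟨B, x, y, hx, hy, hxy, hW⟩ := ht' (stage n) e
  refine ⟨B, x, y, hx, hy, hxy.trans (NatTrans.congr_app (map_Z n).symm e), ?_⟩
  have : colimit.ι Z (n + 1) ≫ colimit.desc Z s = (stage (n + 1)).1.2 := colimit.ι_desc s (n + 1)
  exact (congrArg (fun r => W (y ≫ NatTrans.app r e)) this).mpr hW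

end Factorization

end IsCofibrationCategory

section Lifting

variable {M : Type u} [Category.{v} M] {D : Type w} [SmallCategory D]
  {W Cof : MorphismProperty M}

variable (W Cof) in
/-- The weak form of the lifting property against pointwise weak equivalences `r` with pointwise
cofibrant domain: a lift exists after `r` has been factored as a trivial relative cell complex
followed by some map. -/
def LiftsAgainstWeq {P P' : D ⥤ M} (f : P ⟶ P') : Prop :=
  ∀ ⦃Z Y : D ⥤ M⦄ (p : P ⟶ Z) (y : P' ⟶ Y) (r : Z ⟶ Y), (∀ e, IsCofibrant Cof (Z.obj e)) →
    W.functorCategory D r → f ≫ y = p ≫ r →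
    ∃ (Z' : D ⥤ M) (t : Z ⟶ Z') (r' : Z' ⟶ Y) (s : P' ⟶ Z'),
      Cell Cof (Cof ⊓ W) t ∧ t ≫ r' = r ∧ f ≫ s = p ≫ t ∧ s ≫ r' = y

namespace IsCofibrationCategory

variable (h : IsCofibrationCategory.{w} W Cof)

include h

lemma weq_of_trivial_cell_comp {Z Z' Y : D ⥤ M} {t : Z ⟶ Z'} (ht : Cell Cof (Cof ⊓ W) t)
    (hZ : ∀ e, IsCofibrant Cof (Z.obj e)) {r' : Z' ⟶ Y} (hr : W.functorCategory D (t ≫ r')) :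
    W.functorCategory D r' :=
  have := h.two_out_of_three
  fun e => W.of_precomp _ _ (h.weq_app_of_cell ht hZ e) (hr e)

lemma exists_trivial_cof_lift {A B V Y : M} {i : A ⟶ B} (hi : Cof i) (hA : IsCofibrant Cof A)
    (hV : IsCofibrant Cof V) {g : A ⟶ V} {r : V ⟶ Y} (hr : W r) {b : B ⟶ Y} (w : i ≫ b = g ≫ r) :
    ∃ (N : M) (a : V ⟶ N) (b' : B ⟶ N) (n : N ⟶ Y),
      Cof a ∧ W a ∧ i ≫ b' = g ≫ a ∧ a ≫ n = r ∧ b' ≫ n = b := by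
  have := h.two_out_of_three
  have := h.hasPushout i g hi hA hV
  have hp := IsPushout.of_hasPushout i g
  have hj := h.cof_pushout i g _ _ hi hA hV hp
  obtain ⟨N, k, n, hk, hn, hkn⟩ := h.factorization (hp.desc b r w) (h.isCofibrant_of_cof hV hj)
  have fac : (pushout.inr i g ≫ k) ≫ n = r := by simp [hkn]
  exact ⟨N, pushout.inr i g ≫ k, pushout.inl i g ≫ k, n, h.cof_comp _ _ hj hk,
    W.of_postcomp _ n hn (by rwa [fac]), by simp [hp.w_assoc], fac, by simp [hkn]⟩

lemma liftsAgainstWeq_of_isCellAttachment {S : Type w} {d : S → D} {A B : S → M}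
    {f : ∀ s, A s ⟶ B s} {P P' : D ⥤ M} {α : ∀ s, A s ⟶ P.obj (d s)} {t : P ⟶ P'}
    {β : ∀ s, B s ⟶ P'.obj (d s)} (hA : ∀ s, IsCofibrant Cof (A s)) (hf : ∀ s, Cof (f s))
    (ht : IsCellAttachment f α t β) : LiftsAgainstWeq W Cof t := by
  intro Z Y p y r hZ hr w
  have ht := ht.isPushoutAlong
  have w_cell (s : S) : f s ≫ β s ≫ y.app (d s) = (α s ≫ p.app (d s)) ≫ r.app (d s) := by
    have : f s ≫ β s = α s ≫ t.app (d s) := congrFun ht.w s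
    have w : t.app (d s) ≫ y.app (d s) = p.app (d s) ≫ r.app (d s) := NatTrans.congr_app w (d s)
    rw [reassoc_of% this, w, Category.assoc]
  choose N a b n ha ha' hab han hbn using fun s =>
    h.exists_trivial_cof_lift (hf s) (hA s) (hZ (d s)) (hr (d s)) (w_cell s)
  obtain ⟨Z', t', β', ht'⟩ :=
    h.exists_isCellAttachment (fun s => 𝟙 (Z.obj (d s))) (fun s => hZ (d s)) ha hZ
  have cell : Cell Cof (Cof ⊓ W) t' := .attach (fun s => hZ (d s)) (fun s => ⟨ha s, ha' s⟩) ht'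
  have ht' := ht'.isPushoutAlong
  have w' (s : S) : a s ≫ β' s = t'.app (d s) := (congrFun ht'.w s).trans (Category.id_comp _)
  obtain ⟨r', hβr', htr'⟩ := ht'.exists_desc n r <| funext fun s =>
    (han s).trans (Category.id_comp _).symm
  obtain ⟨l, hβl, htl⟩ := ht.exists_desc (fun s => b s ≫ β' s) (p ≫ t') <| funext fun s => by
    change f s ≫ b s ≫ β' s = α s ≫ p.app (d s) ≫ t'.app (d s)
    rw [reassoc_of% (hab s), w']
  refine ⟨Z', t', r', l, cell, htr', htl, ht.hom_ext (funext fun s => ?_) ?_⟩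
  · have hβl : β s ≫ l.app (d s) = b s ≫ β' s := congrFun hβl s
    have hβr' : β' s ≫ r'.app (d s) = n s := congrFun hβr' s
    change β s ≫ l.app (d s) ≫ r'.app (d s) = β s ≫ y.app (d s)
    rw [reassoc_of% hβl, hβr', hbn]
  · rw [reassoc_of% htl, htr', w]

lemma liftsAgainstWeq_comp {P P' P'' : D ⥤ M} {f : P ⟶ P'} {f' : P' ⟶ P''}
    (hf : LiftsAgainstWeq W Cof f) (hf' : LiftsAgainstWeq W Cof f') :
    LiftsAgainstWeq W Cof (f ≫ f') := by
  intro Z Y p y r hZ hr w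
  obtain ⟨Z₁, t₁, r₁, l₁, ht₁, rfl, w₁, hl₁⟩ := hf p (f' ≫ y) r hZ hr (by simpa using w)
  obtain ⟨Z₂, t₂, r₂, l₂, ht₂, rfl, w₂, hl₂⟩ := hf' l₁ y r₁
    (h.isCofibrant_obj_of_cell inf_le_left ht₁ hZ) (h.weq_of_trivial_cell_comp ht₁ hZ hr) hl₁.symm
  exact ⟨Z₂, t₁ ≫ t₂, r₂, l₂, .comp ht₁ ht₂, Category.assoc _ _ _,
    by rw [Category.assoc, w₂, reassoc_of% w₁], hl₂⟩

lemma liftsAgainstWeq_ι_zero {A : ℕ ⥤ D ⥤ M} {c : Cocone A} (hc : IsColimit c)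
    (hA : ∀ n : ℕ, LiftsAgainstWeq W Cof (A.map (homOfLE n.le_succ))) :
    LiftsAgainstWeq W Cof (c.ι.app 0) := by
  intro Z Y p y r hZ hr w
  let Stage (n : ℕ) := {q : Σ Z : D ⥤ M, (A.obj n ⟶ Z) × (Z ⟶ Y) //
    (∀ e, IsCofibrant Cof (q.1.obj e)) ∧ W.functorCategory D q.2.2 ∧
      c.ι.app n ≫ y = q.2.1 ≫ q.2.2}
  have step (n : ℕ) (q : Stage n) : ∃ (q' : Stage (n + 1)) (t : q.1.1 ⟶ q'.1.1),
      Cell Cof (Cof ⊓ W) t ∧ t ≫ q'.1.2.2 = q.1.2.2 ∧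
        A.map (homOfLE n.le_succ) ≫ q'.1.2.1 = q.1.2.1 ≫ t := by
    obtain ⟨⟨Z, p, r⟩, hZ, hr, w⟩ := q
    obtain ⟨Z', t, r', l, ht, rfl, hl, hl'⟩ := hA n p (c.ι.app (n + 1) ≫ y) r hZ hr
      ((c.w_assoc _ _).trans w)
    exact ⟨⟨⟨Z', l, r'⟩, h.isCofibrant_obj_of_cell inf_le_left ht hZ,
      h.weq_of_trivial_cell_comp ht hZ hr, hl'.symm⟩, t, ht, rfl, hl⟩
  choose next t ht hr' hl using step
  let stage (n : ℕ) : Stage n := Nat.rec ⟨⟨Z, p, r⟩, hZ, hr, w⟩ next n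
  let Z' : ℕ ⥤ D ⥤ M := Functor.ofSequence fun n => t n (stage n)
  have map_Z' (n : ℕ) : Z'.map (homOfLE n.le_succ) = t n (stage n) :=
    Functor.ofSequence_map_homOfLE_succ _ n
  have hZ' (n : ℕ) : Cell Cof (Cof ⊓ W) (Z'.map (homOfLE n.le_succ)) := by
    rw [map_Z']
    exact ht n (stage n)
  have := h.hasColimit_functor (A := Z') hZ fun n =>
    h.cof_app_of_cell inf_le_left (hZ' n) (stage n).2.1
  let l : A ⟶ Z' := NatTrans.ofSequence (fun n => (stage n).1.2.1) fun n =>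
    (hl n (stage n)).trans (congrArg (_ ≫ ·) (map_Z' n).symm)
  let r' : Cocone Z' := ⟨Y, NatTrans.ofSequence (fun n => (stage n).1.2.2) fun n =>
    ((congrArg (· ≫ _) (map_Z' n)).trans (hr' n (stage n))).trans (Category.comp_id _).symm⟩
  refine ⟨colimit Z', colimit.ι Z' 0, colimit.desc Z' r', hc.map (colimit.cocone Z') l,
    .seq (colimit.isColimit Z') hZ', colimit.ι_desc r' 0, hc.ι_map _ l 0, hc.hom_ext fun n => ?_⟩
  rw [hc.ι_map_assoc, colimit.cocone_ι, colimit.ι_desc]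
  exact (stage n).2.2.2.symm

lemma liftsAgainstWeq_of_cell {P P' : D ⥤ M} {f : P ⟶ P'} (hf : Cell Cof Cof f) :
    LiftsAgainstWeq W Cof f := by
  induction hf with
  | attach hA hf ht => exact h.liftsAgainstWeq_of_isCellAttachment hA hf ht
  | comp _ _ ih ih' => exact h.liftsAgainstWeq_comp ih ih'
  | seq hc _ ih => exact h.liftsAgainstWeq_ι_zero hc ih

end IsCofibrationCategory

end Lifting

/-! ### Cellular diagrams -/

section Cellular

lemma isInvertedBy_of_exists_factorization {C H : Type*} [Category* C] [Category* H]
    {W : MorphismProperty C} (F : C ⥤ H)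
    (hF : ∀ ⦃X Y : C⦄ (f : X ⟶ Y), W f → ∃ (Z : C) (t : X ⟶ Z) (r : Z ⟶ Y) (s : Y ⟶ Z),
      IsIso (F.map t) ∧ W s ∧ t ≫ r = f ∧ s ≫ r = 𝟙 Y) : W.IsInvertedBy F := by
  intro X Y f hf
  obtain ⟨Z, t, r, s, ht, hs, rfl, hsr⟩ := hF f hf
  obtain ⟨Z', t', r', s', ht', -, rfl, hsr'⟩ := hF s hs
  have fac : F.map (t' ≫ r') ≫ F.map r = 𝟙 _ := by rw [← F.map_comp, hsr, F.map_id]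
  have : IsSplitMono (F.map (t' ≫ r')) := ⟨⟨⟨F.map r, fac⟩⟩⟩
  have : IsSplitEpi (F.map (t' ≫ r')) := ⟨⟨⟨F.map s' ≫ inv (F.map t'), by
    rw [F.map_comp, Category.assoc, IsIso.inv_hom_id_assoc, ← F.map_comp, hsr', F.map_id]⟩⟩⟩
  have : IsIso (F.map (t' ≫ r')) := isIso_of_epi_of_isSplitMono _
  have : IsIso (F.map r) := by
    rw [IsIso.eq_inv_of_hom_inv_id fac]
    infer_instance
  rw [F.map_comp]
  infer_instance

lemma hasTwoOutOfThreeProperty_functorCategory {C : Type*} [Category* C]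
    (W : MorphismProperty C) [W.HasTwoOutOfThreeProperty] (D : Type*) [Category* D] :
    (W.functorCategory D).HasTwoOutOfThreeProperty where
  comp_mem _ _ hf hg e := W.comp_mem _ _ (hf e) (hg e)
  of_postcomp _ _ hg hfg e := W.of_postcomp _ _ (hg e) (hfg e)
  of_precomp _ _ hf hfg e := W.of_precomp _ _ (hf e) (hfg e)

variable {M : Type u} [Category.{v} M] {D : Type w} [SmallCategory D]
  {W Cof : MorphismProperty M}

variable (Cof) in
/-- The cellular diagrams: those built from the initial diagram by gluing in free cells on
cofibrations. They resolve all diagrams, and the partial left adjoints of the functors `res M F` are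
defined on them. -/
def IsCellular : ObjectProperty (D ⥤ M) :=
  fun X => ∃ (I : D ⥤ M) (_ : IsInitial I) (f : I ⟶ X), Cell Cof Cof f

lemma IsCellular.of_cell {X Y : D ⥤ M} (hX : IsCellular Cof X) {f : X ⟶ Y}
    (hf : Cell Cof Cof f) : IsCellular Cof Y :=
  let ⟨I, hI, g, hg⟩ := hX
  ⟨I, hI, g ≫ f, .comp hg hf⟩

namespace IsCofibrationCategory

variable (h : IsCofibrationCategory.{w} W Cof)

include h

lemma isCofibrant_obj_of_isInitial {I : D ⥤ M} (hI : IsInitial I) (e : D) :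
    IsCofibrant Cof (I.obj e) :=
  let ⟨_, ⟨hK⟩, _⟩ := h.exists_initial
  h.isCofibrant_of_isInitial <|
    hK.ofIso (((Functor.isInitialConst D hK).uniqueUpToIso hI).app e)

lemma isCofibrant_obj_of_isCellular {X : D ⥤ M} (hX : IsCellular Cof X) (e : D) :
    IsCofibrant Cof (X.obj e) :=
  let ⟨_, hI, _, hf⟩ := hX
  h.isCofibrant_obj_of_cell le_rfl hf (h.isCofibrant_obj_of_isInitial hI) e

section Resolving

lemma exists_isCellular_weq (X : D ⥤ M) :
    ∃ (P : D ⥤ M) (q : P ⟶ X), IsCellular Cof P ∧ W.functorCategory D q := by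
  obtain ⟨K, ⟨hK⟩, -⟩ := h.exists_initial
  have hI := Functor.isInitialConst D hK
  obtain ⟨P, i, q, hi, hq, -⟩ :=
    h.exists_cell_factorization (h.isCofibrant_obj_of_isInitial hI) (hI.to X)
  exact ⟨P, q, ⟨_, hI, i, hi⟩, hq⟩

lemma exists_trivial_cell_lift {P Z X : D ⥤ M} (hP : IsCellular Cof P) (hZ : IsCellular Cof Z)
    (a : P ⟶ X) (b : Z ⟶ X) (hb : W.functorCategory D b) :
    ∃ (Z' : D ⥤ M) (s : P ⟶ Z') (t : Z ⟶ Z') (r : Z' ⟶ X), Cell Cof (Cof ⊓ W) t ∧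
      s ≫ r = a ∧ t ≫ r = b := by
  obtain ⟨I, hI, f, hf⟩ := hP
  obtain ⟨Z', t, r, s, ht, htr, -, hsr⟩ := h.liftsAgainstWeq_of_cell hf (hI.to Z) a b
    (h.isCofibrant_obj_of_isCellular hZ) hb (hI.hom_ext _ _)
  exact ⟨Z', s, t, r, ht, hsr, htr⟩

lemma exists_isColimit_binaryCofan {P V : D ⥤ M} (hP : IsCellular Cof P)
    (hV : ∀ e, IsCofibrant Cof (V.obj e)) :
    ∃ (N : D ⥤ M) (i : P ⟶ N) (j : V ⟶ N), Cell Cof Cof j ∧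
      Nonempty (IsColimit (BinaryCofan.mk i j)) := by
  obtain ⟨I, hI, f, hf⟩ := hP
  obtain ⟨N, j, i : P ⟶ N, hj, hp⟩ := h.exists_isPushoutAlong_res (𝟭 D) le_rfl hf hV (hI.to V)
  choose desc hi hj' using fun {Y} (b : P ⟶ Y) (y : V ⟶ Y) =>
    hp.exists_desc b y (hI.hom_ext _ _)
  exact ⟨N, i, j, hj, ⟨BinaryCofan.IsColimit.mk _ desc hi hj' fun b y l hl hl' =>
    hp.hom_ext (hl.trans (hi b y).symm) (hl'.trans (hj' b y).symm)⟩⟩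

lemma exists_isCellular_cylinder {P Z Y : D ⥤ M} (a b : P ⟶ Z) (r : Z ⟶ Y)
    (hP : IsCellular Cof P) (hZ : IsCellular Cof Z) (hr : W.functorCategory D r)
    (hab : a ≫ r = b ≫ r) :
    ∃ (I Z' : D ⥤ M) (i₀ i₁ : P ⟶ I) (s : I ⟶ P) (z : Z ⟶ Z') (c : I ⟶ Z'),
      IsCellular Cof I ∧ IsCellular Cof Z' ∧ W.functorCategory D s ∧ W.functorCategory D z ∧
        i₀ ≫ s = 𝟙 P ∧ i₁ ≫ s = 𝟙 P ∧ i₀ ≫ c = a ≫ z ∧ i₁ ≫ c = b ≫ z := by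
  obtain ⟨N, j₀, j₁, hj₁, ⟨hN⟩⟩ :=
    h.exists_isColimit_binaryCofan hP (h.isCofibrant_obj_of_isCellular hP)
  have N_cellular := hP.of_cell hj₁
  obtain ⟨(fold : N ⟶ P), (fold₀ : j₀ ≫ fold = 𝟙 P), (fold₁ : j₁ ≫ fold = 𝟙 P)⟩ :=
    BinaryCofan.IsColimit.desc' hN (𝟙 P) (𝟙 P)
  obtain ⟨(ab : N ⟶ Z), (ab₀ : j₀ ≫ ab = a), (ab₁ : j₁ ≫ ab = b)⟩ :=
    BinaryCofan.IsColimit.desc' hN a b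
  obtain ⟨I, i, s, hi, hs, rfl⟩ :=
    h.exists_cell_factorization (h.isCofibrant_obj_of_isCellular N_cellular) fold
  have comm₀ : j₀ ≫ i ≫ s ≫ a ≫ r = j₀ ≫ ab ≫ r := by
    rw [reassoc_of% fold₀, reassoc_of% ab₀]
  have comm₁ : j₁ ≫ i ≫ s ≫ a ≫ r = j₁ ≫ ab ≫ r := by
    rw [reassoc_of% fold₁, reassoc_of% ab₁, hab]
  obtain ⟨Z', z, r', c, hz, -, hc, -⟩ := h.liftsAgainstWeq_of_cell hi ab (s ≫ a ≫ r) r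
    (h.isCofibrant_obj_of_isCellular hZ) hr (BinaryCofan.IsColimit.hom_ext hN comm₀ comm₁)
  exact ⟨I, Z', j₀ ≫ i, j₁ ≫ i, s, z, c, N_cellular.of_cell hi,
    hZ.of_cell (hz.mono inf_le_left), hs,
    h.weq_app_of_cell hz (h.isCofibrant_obj_of_isCellular hZ), by simp [fold₀], by simp [fold₁],
    by rw [Category.assoc, hc, reassoc_of% ab₀], by rw [Category.assoc, hc, reassoc_of% ab₁]⟩

lemma isResolving_isCellular :
    IsResolving (W.functorCategory D) (IsCellular (D := D) Cof) where
  exists_resolution := h.exists_isCellular_weq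
  exists_cospan a b hP hP' hb := by
    obtain ⟨Z, s, t, r, ht, rfl, rfl⟩ := h.exists_trivial_cell_lift hP hP' a b hb
    exact ⟨Z, s, t, r, hP'.of_cell (ht.mono inf_le_left),
      h.weq_of_trivial_cell_comp ht (h.isCofibrant_obj_of_isCellular hP') hb, rfl, rfl⟩
  exists_cylinder := h.exists_isCellular_cylinder

end Resolving

lemma isInvertedBy_of_inverts_trivial_cell {H : Type*} [Category* H]
    (Ψ : (IsCellular (D := D) Cof).FullSubcategory ⥤ H)
    (hΨ : ∀ {P P' : (IsCellular (D := D) Cof).FullSubcategory} (t : P ⟶ P'),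
      Cell Cof (Cof ⊓ W) t.hom → IsIso (Ψ.map t)) :
    ((W.functorCategory D).inverseImage (IsCellular Cof).ι).IsInvertedBy Ψ := by
  refine isInvertedBy_of_exists_factorization Ψ fun P P' f hf => ?_
  obtain ⟨Z, s, t, r, ht, hsr, htr⟩ :=
    h.exists_trivial_cell_lift P'.property P.property (𝟙 P'.obj) f.hom hf
  let Q : (IsCellular (D := D) Cof).FullSubcategory :=
    ⟨Z, P.property.of_cell (ht.mono inf_le_left)⟩
  have hr : W.functorCategory D r :=
    h.weq_of_trivial_cell_comp ht (h.isCofibrant_obj_of_isCellular P.property) (by rwa [htr])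
  have hs : W.functorCategory D s := fun e =>
    have := h.two_out_of_three
    W.of_postcomp _ _ (hr e) (h.weq_of_isIso _ (by rw [← NatTrans.comp_app, hsr]; infer_instance))
  exact ⟨Q, ObjectProperty.homMk t, ObjectProperty.homMk r, ObjectProperty.homMk s,
    hΨ (P' := Q) (ObjectProperty.homMk t) ht, hs, ObjectProperty.hom_ext _ htr,
    ObjectProperty.hom_ext _ hsr⟩

section LeftKanExtension

variable {E : Type w} [SmallCategory E] (F : D ⥤ E)

lemma exists_isUniversalArrow_res {X : D ⥤ M} (hX : IsCellular Cof X) :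
    ∃ (V : E ⥤ M) (g : X ⟶ (res M F).obj V), IsUniversalArrow (res M F) g ∧
      IsCellular Cof V := by
  obtain ⟨I, hI, f, hf⟩ := hX
  obtain ⟨K, ⟨hK⟩, -⟩ := h.exists_initial
  have hJ := Functor.isInitialConst E hK
  obtain ⟨V, j, g, hj, hg⟩ :=
    h.exists_isPushoutAlong_res F le_rfl hf (h.isCofibrant_obj_of_isInitial hJ) (hI.to _)
  exact ⟨V, g, hg.isUniversalArrow (isUniversalArrow_of_isInitial hI hJ _), _, hJ, j, hj⟩

lemma isCellular_le_leftAdjointObjIsDefined :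
    IsCellular Cof ≤ (res M F).leftAdjointObjIsDefined := fun _ hX =>
  let ⟨_, _, hg, _⟩ := h.exists_isUniversalArrow_res F hX
  hg.leftAdjointObjIsDefined

variable {F} {X : D ⥤ M} (hX : IsCellular Cof X) {V : E ⥤ M} {g : X ⟶ (res M F).obj V}
  (hg : IsUniversalArrow (res M F) g)

include hX hg

lemma isCellular_of_isUniversalArrow : IsCellular Cof V := by
  obtain ⟨V₀, g₀, hg₀, hV₀⟩ := h.exists_isUniversalArrow_res F hX
  obtain ⟨l, hl, -⟩ := hg₀ V g
  have := hg₀.isIso hg hl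
  exact hV₀.of_cell (.of_isIso l)

/-- `V'` is obtained from `V` by gluing in the cells of `t`, up to an isomorphism. -/
lemma weq_of_comp_map_eq_trivial_cell_comp {X' : D ⥤ M} {t : X ⟶ X'}
    (ht : Cell Cof (Cof ⊓ W) t) {V' : E ⥤ M} {g' : X' ⟶ (res M F).obj V'}
    (hg' : IsUniversalArrow (res M F) g') {m : V ⟶ V'} (hm : g ≫ (res M F).map m = t ≫ g') :
    W.functorCategory E m := by
  have := h.two_out_of_three
  have hV := h.isCofibrant_obj_of_isCellular (h.isCellular_of_isUniversalArrow hX hg)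
  obtain ⟨V₁, j, g₁, hj, hg₁⟩ := h.exists_isPushoutAlong_res F inf_le_left ht hV g
  obtain ⟨l, hl, rfl⟩ := hg₁.exists_desc g' m hm.symm
  have := (hg₁.isUniversalArrow hg).isIso hg' hl
  exact fun e => W.comp_mem _ _ (h.weq_app_of_cell hj hV e) (h.weq_of_isIso _ inferInstance)

end LeftKanExtension

/-- The homotopy colimit relative to arbitrary models of the localizations and of the domain of the
colimit functor, which allows it to be applied to the opposite of a fibration category. -/
theorem exists_homotopyColimit {E : Type w} [SmallCategory E] (F : D ⥤ E)
    {H₁ H₂ C₀ : Type*} [Category* H₁] [Category* H₂] [Category* C₀]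
    (Q₁ : (D ⥤ M) ⥤ H₁) [Q₁.IsLocalization (W.functorCategory D)]
    (Q₂ : (E ⥤ M) ⥤ H₂) [Q₂.IsLocalization (W.functorCategory E)]
    (G' : H₂ ⥤ H₁) (e : res M F ⋙ Q₁ ≅ Q₂ ⋙ G') (i : C₀ ⥤ D ⥤ M) [i.Full] (T : C₀ ⥤ E ⥤ M)
    (η : i ⟶ T ⋙ res M F) (hη : ∀ X, IsUniversalArrow (res M F) (η.app X))
    (k : (res M F).PartialLeftAdjointSource ⥤ C₀)
    (κ : k ⋙ i ≅ (res M F).leftAdjointObjIsDefined.ι) :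
    ∃ (L : H₁ ⥤ H₂) (ε : (i ⋙ Q₁) ⋙ L ⟶ T ⋙ Q₂) (adj : L ⊣ G'), L.IsRightKanExtension ε ∧
      ∀ X : C₀, adj.unit.app (Q₁.obj (i.obj X)) ≫ G'.map (ε.app X) =
        Q₁.map (η.app X) ≫ e.hom.app (T.obj X) := by
  have := h.two_out_of_three
  have := hasTwoOutOfThreeProperty_functorCategory W D
  let incl := ObjectProperty.ιOfLE (h.isCellular_le_leftAdjointObjIsDefined F)
  let k' : (IsCellular (D := D) Cof).FullSubcategory ⥤ C₀ := incl ⋙ k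
  let κ' : k' ⋙ i ≅ (IsCellular Cof).ι := Functor.isoWhiskerLeft incl κ
  refine exists_isRightKanExtension_adjunction h.isResolving_isCellular e k' κ'
    (W.functorCategory E) (fun P => hη _) (h.isInvertedBy_of_inverts_trivial_cell _ fun t ht => ?_)
  have κ_naturality : t.hom ≫ κ'.inv.app _ = κ'.inv.app _ ≫ i.map (k'.map t) :=
    κ'.inv.naturality t
  have η_naturality : i.map (k'.map t) ≫ η.app _ = η.app _ ≫ (res M F).map (T.map (k'.map t)) :=
    η.naturality (k'.map t)
  refine Localization.inverts Q₂ (W.functorCategory E) _ <|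
    h.weq_of_comp_map_eq_trivial_cell_comp (ObjectProperty.FullSubcategory.property _)
      ((hη _).iso_comp (κ'.symm.app _)) ht ((hη _).iso_comp (κ'.symm.app _)) ?_
  change (κ'.inv.app _ ≫ η.app _) ≫ (res M F).map (T.map (k'.map t)) =
    t.hom ≫ κ'.inv.app _ ≫ η.app _
  rw [Category.assoc, ← η_naturality, reassoc_of% κ_naturality]

end IsCofibrationCategory

end Cellular

/-! ### Opposites -/

section Duality

lemma sigmaMap_op_eq {C I : Type*} [Category* C] {A B : I → C} (f : ∀ i, A i ⟶ B i)
    [HasProduct A] [HasProduct B] :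
    Limits.Sigma.map (fun i => (f i).op) =
      (opProductIsoCoproduct B).inv ≫ (Limits.Pi.map f).op ≫ (opProductIsoCoproduct A).hom := by
  refine Sigma.hom_ext _ _ fun i => ?_
  have π_naturality : (Pi.π B i).op ≫ (Limits.Pi.map f).op = (f i).op ≫ (Pi.π A i).op := by
    rw [← op_comp, Pi.map_π, op_comp]
  rw [Sigma.ι_map, ← π_comp_opProductIsoCoproduct_hom B, ← π_comp_opProductIsoCoproduct_hom A,
    Category.assoc, Iso.hom_inv_id_assoc, reassoc_of% π_naturality]

variable {M : Type u} [Category.{v} M] {W Fib : MorphismProperty M}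

lemma isCofibrant_op_iff {A : Mᵒᵖ} : IsCofibrant Fib.op A ↔ IsFibrant Fib A.unop where
  mp := fun ⟨_, hI, hc⟩ => ⟨_, terminalUnopOfInitial hI, hc⟩
  mpr := fun ⟨_, hT, hc⟩ => ⟨_, initialOpOfTerminal hT, hc⟩

namespace IsFibrationCategory

variable (h : IsFibrationCategory.{w} W Fib)

include h

lemma isFibrant_of_fib {A B : M} {f : A ⟶ B} (hB : IsFibrant Fib B) (hf : Fib f) :
    IsFibrant Fib A :=
  let ⟨T, hT, hc⟩ := hB
  ⟨T, hT, hT.hom_ext (f ≫ hT.from B) (hT.from A) ▸ h.fib_comp _ _ hf hc⟩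

lemma isFibrant_of_iso {A B : M} (e : A ≅ B) (hB : IsFibrant Fib B) : IsFibrant Fib A :=
  h.isFibrant_of_fib hB (h.fib_of_isIso e.hom inferInstance hB)

lemma fib_isIso_comp {A B C : M} (e : A ⟶ B) [IsIso e] {f : B ⟶ C} (hC : IsFibrant Fib C)
    (hf : Fib f) : Fib (e ≫ f) :=
  h.fib_comp _ _ (h.fib_of_isIso e inferInstance (h.isFibrant_of_fib hC hf)) hf

lemma fib_comp_isIso {A B C : M} {f : A ⟶ B} (e : B ⟶ C) [IsIso e] (hC : IsFibrant Fib C)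
    (hf : Fib f) : Fib (f ≫ e) :=
  h.fib_comp _ _ hf (h.fib_of_isIso e inferInstance hC)

lemma weq_isIso_comp {A B C : M} (e : A ⟶ B) [IsIso e] {f : B ⟶ C} (hf : W f) : W (e ≫ f) :=
  have := h.two_out_of_three
  W.comp_mem _ _ (h.weq_of_isIso e inferInstance) hf

lemma op_coproduct {I : Type w} (A B : I → Mᵒᵖ) (f : ∀ i, A i ⟶ B i)
    (hA : ∀ i, IsCofibrant Fib.op (A i)) (hf : ∀ i, Fib.op (f i)) :
    ∃ (_ : HasCoproduct A) (_ : HasCoproduct B),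
      IsCofibrant Fib.op (∐ A) ∧ IsCofibrant Fib.op (∐ B) ∧ Fib.op (Limits.Sigma.map f) ∧
        ((∀ i, W.op (f i)) → W.op (Limits.Sigma.map f)) := by
  have := h.two_out_of_three
  obtain ⟨_, _, hB, hA, hF, hW⟩ := h.product (fun i => (B i).unop) (fun i => (A i).unop)
    (fun i => (f i).unop) (fun i => isCofibrant_op_iff.1 (hA i)) hf
  have : HasCoproduct A := inferInstanceAs (HasCoproduct fun i => Opposite.op (A i).unop)
  have : HasCoproduct B := inferInstanceAs (HasCoproduct fun i => Opposite.op (B i).unop)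
  let eA := (opProductIsoCoproduct fun i => (A i).unop).unop
  let eB := (opProductIsoCoproduct fun i => (B i).unop).unop
  have map_f : (Limits.Sigma.map f).unop =
      eB.hom ≫ Limits.Pi.map (fun i => (f i).unop) ≫ eA.inv :=
    (congrArg Quiver.Hom.unop (sigmaMap_op_eq _)).trans (Category.assoc _ _ _)
  have hA' : IsFibrant Fib (∐ A).unop := h.isFibrant_of_iso eA hA
  refine ⟨‹_›, ‹_›, isCofibrant_op_iff.2 hA', isCofibrant_op_iff.2 (h.isFibrant_of_iso eB hB),
    ?_, fun hf => ?_⟩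
  · change Fib (Limits.Sigma.map f).unop
    exact map_f ▸ h.fib_isIso_comp _ hA' (h.fib_comp_isIso _ hA' hF)
  · change W (Limits.Sigma.map f).unop
    exact map_f ▸ h.weq_isIso_comp _ (W.comp_mem _ _ (hW hf) (h.weq_of_isIso _ inferInstance))

lemma op_sequence (A : ℕ ⥤ Mᵒᵖ) (h₀ : IsCofibrant Fib.op (A.obj 0))
    (hA : ∀ n : ℕ, Fib.op (A.map (homOfLE n.le_succ))) :
    ∃ _ : HasColimit A, Fib.op (colimit.ι A 0) ∧
      ((∀ n : ℕ, W.op (A.map (homOfLE n.le_succ))) → W.op (colimit.ι A 0)) := by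
  obtain ⟨_, hF, hW⟩ := h.sequence A.leftOp (isCofibrant_op_iff.1 h₀) hA
  have : HasColimit A := ⟨⟨_, isColimitCoconeOfConeLeftOp A (limit.isLimit A.leftOp)⟩⟩
  have ι_zero : (limitLeftOpIsoUnopColimit A).inv ≫ limit.π A.leftOp (Opposite.op 0) =
      (colimit.ι A 0).unop := limitLeftOpIsoUnopColimit_inv_comp_π A (Opposite.op 0)
  refine ⟨‹_›, ?_, fun hw => ?_⟩
  · change Fib (colimit.ι A 0).unop
    exact ι_zero ▸ h.fib_isIso_comp _ (isCofibrant_op_iff.1 h₀) hF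
  · change W (colimit.ι A 0).unop
    exact ι_zero ▸ h.weq_isIso_comp _ (hW hw)

lemma op : IsCofibrationCategory.{w} W.op Fib.op where
  exists_initial :=
    let ⟨_, ⟨hT⟩, hc⟩ := h.exists_terminal
    ⟨_, ⟨initialOpOfTerminal hT⟩, isCofibrant_op_iff.2 hc⟩
  cof_comp _ _ hf hg := h.fib_comp _ _ hg hf
  weq_of_isIso _ _ := h.weq_of_isIso _ inferInstance
  cof_of_isIso _ _ hA := h.fib_of_isIso _ inferInstance (isCofibrant_op_iff.1 hA)
  two_out_of_three :=
    have := h.two_out_of_three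
    inferInstance
  hasPushout i g hi hA hC :=
    have := h.hasPullback i.unop g.unop hi (isCofibrant_op_iff.1 hA) (isCofibrant_op_iff.1 hC)
    (IsPullback.of_hasPullback i.unop g.unop).op.flip.hasPushout
  cof_pushout i g k j hi hA hC hp :=
    h.fib_pullback i.unop g.unop k.unop j.unop hi (isCofibrant_op_iff.1 hA)
      (isCofibrant_op_iff.1 hC) hp.unop.flip
  weq_pushout i g k j hi hw hA hC hp :=
    h.weq_pullback i.unop g.unop k.unop j.unop hi hw (isCofibrant_op_iff.1 hA)
      (isCofibrant_op_iff.1 hC) hp.unop.flip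
  factorization f hA :=
    let ⟨X, s, f', hs, hf', hsf⟩ := h.factorization f.unop (isCofibrant_op_iff.1 hA)
    ⟨Opposite.op X, f'.op, s.op, hf', hs, Quiver.Hom.unop_inj hsf⟩
  coproduct := h.op_coproduct
  sequence := h.op_sequence

end IsFibrationCategory

end Duality

/-! ### Homotopy colimits and limits -/

section KanExtensionAdjunction

variable {C₀ H₁ H₂ : Type*} [Category* C₀] [Category* H₁] [Category* H₂]
  {p : C₀ ⥤ H₁} {t : C₀ ⥤ H₂} {G : H₂ ⥤ H₁}

lemma exists_adjunction_of_isRightKanExtension {L L' : H₁ ⥤ H₂} {ε : p ⋙ L ⟶ t}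
    {ε' : p ⋙ L' ⟶ t} (hL : L.IsRightKanExtension ε) (hL' : L'.IsRightKanExtension ε')
    (adj : L ⊣ G) : ∃ adj' : L' ⊣ G, ∀ X : C₀,
      adj'.unit.app (p.obj X) ≫ G.map (ε'.app X) = adj.unit.app (p.obj X) ≫ G.map (ε.app X) := by
  let θ := L.rightKanExtensionUnique ε L' ε'
  refine ⟨adj.ofNatIsoLeft θ, fun X => ?_⟩
  have hθ : θ.hom.app (p.obj X) ≫ ε'.app X = ε.app X := by
    simp [θ]
  simp [← hθ]

lemma exists_adjunction_of_isLeftKanExtension {R R' : H₁ ⥤ H₂} {ν : t ⟶ p ⋙ R}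
    {ν' : t ⟶ p ⋙ R'} (hR : R.IsLeftKanExtension ν) (hR' : R'.IsLeftKanExtension ν')
    (adj : G ⊣ R) : ∃ adj' : G ⊣ R', ∀ X : C₀, G.map (ν'.app X) ≫ adj'.counit.app (p.obj X) =
      G.map (ν.app X) ≫ adj.counit.app (p.obj X) := by
  let θ := R.leftKanExtensionUnique ν R' ν'
  refine ⟨adj.ofNatIsoRight θ, fun X => ?_⟩
  have hθ : ν'.app X ≫ θ.inv.app (p.obj X) = ν.app X := by
    simp [θ]
  simp [← hθ]

end KanExtensionAdjunction

section OppositeKanExtension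

variable {C₀ H₁ H₂ : Type*} [Category* C₀] [Category* H₁] [Category* H₂]
  {p : C₀ ⥤ H₁} {t : C₀ ⥤ H₂} {R : H₁ ⥤ H₂} {ν : t ⟶ p ⋙ R}

lemma isLeftKanExtension_of_op
    (h : R.op.IsRightKanExtension (L := p.op) (F := t.op) (NatTrans.op ν)) :
    R.IsLeftKanExtension ν := by
  let δ (E : p.LeftExtension t) : E.right.op ⟶ R.op :=
    R.op.liftOfIsRightKanExtension (L := p.op) (F := t.op) (NatTrans.op ν) E.right.op
      (NatTrans.op E.hom)
  have hδ (E : p.LeftExtension t) :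
      Functor.whiskerLeft p.op (δ E) ≫ NatTrans.op ν = NatTrans.op E.hom :=
    R.op.liftOfIsRightKanExtension_fac (L := p.op) (F := t.op) (NatTrans.op ν) E.right.op
      (NatTrans.op E.hom)
  refine ⟨⟨IsInitial.ofUniqueHom (fun E => StructuredArrow.homMk (NatTrans.unop (δ E))
    (congrArg NatTrans.unop (hδ E))) fun E f => ?_⟩⟩
  ext1
  exact congrArg NatTrans.unop (R.op.hom_ext_of_isRightKanExtension (L := p.op) (F := t.op)
    (NatTrans.op ν) (NatTrans.op f.right) (δ E)
    ((congrArg NatTrans.op (StructuredArrow.w f)).trans (hδ E).symm))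

end OppositeKanExtension

section PartialAdjoint

variable {C D : Type*} [Category* C] [Category* D] (G : D ⥤ C)

lemma isUniversalArrow_partialLeftAdjointHomEquiv_id (X : G.PartialLeftAdjointSource) :
    IsUniversalArrow G (G.partialLeftAdjointHomEquiv (𝟙 (G.partialLeftAdjointObj X))) :=
  fun Y y => by
  have comp_map (l : G.partialLeftAdjointObj X ⟶ Y) :
      G.partialLeftAdjointHomEquiv (𝟙 _) ≫ G.map l = G.partialLeftAdjointHomEquiv l := by
    rw [← G.partialLeftAdjointHomEquiv_comp, Category.id_comp]
  simpa only [comp_map] using G.partialLeftAdjointHomEquiv.bijective.existsUnique y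

/-- The map `g : G.obj V ⟶ X` is couniversal, i.e. `V` is the value at `X` of a partially defined
right adjoint of `G`. -/
def IsCouniversalArrow (G : D ⥤ C) {X : C} {V : D} (g : G.obj V ⟶ X) : Prop :=
  ∀ (Y : D) (y : G.obj Y ⟶ X), ∃! l : Y ⟶ V, G.map l ≫ g = y

lemma isCouniversalArrow_partialRightAdjointHomEquiv_id (X : G.PartialRightAdjointSource) :
    IsCouniversalArrow G (G.partialRightAdjointHomEquiv (𝟙 (G.partialRightAdjointObj X))) :=
  fun Y y => by
  have map_comp (l : Y ⟶ G.partialRightAdjointObj X) :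
      G.map l ≫ G.partialRightAdjointHomEquiv (𝟙 _) = G.partialRightAdjointHomEquiv l := by
    rw [← G.partialRightAdjointHomEquiv_comp, Category.comp_id]
  simpa only [map_comp] using G.partialRightAdjointHomEquiv.bijective.existsUnique y

variable {G} in
lemma IsCouniversalArrow.rightAdjointObjIsDefined {X : C} {V : D} {g : G.obj V ⟶ X}
    (hg : IsCouniversalArrow G g) : G.rightAdjointObjIsDefined X :=
  Functor.RepresentableBy.isRepresentable (Y := V)
    { homEquiv {Y} := .ofBijective (fun l => G.map l ≫ g)
        ⟨fun _ _ hl => (hg Y _).unique hl rfl, fun y => (hg Y y).exists⟩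
      homEquiv_comp f l := by
        change G.map (f ≫ l) ≫ g = G.map f ≫ G.map l ≫ g
        rw [G.map_comp, Category.assoc] }

end PartialAdjoint

variable {M : Type u} [Category.{v} M] {W : MorphismProperty M}
  {D₁ D₂ : Type w} [SmallCategory D₁] [SmallCategory D₂] (F : D₁ ⥤ D₂)

section HomotopyColimit

variable (M) in
/-- The universal maps `X ⟶ u^* (colim^u X)` as a natural transformation. -/
noncomputable def colimUnitNatTrans : iColim M F ⟶ colimAlong M F ⋙ res M F where
  app X := colimUnit F X
  naturality X Y f := by
    change f.hom ≫ (res M F).partialLeftAdjointHomEquiv (𝟙 _) =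
      (res M F).partialLeftAdjointHomEquiv (𝟙 _) ≫
        (res M F).map ((res M F).partialLeftAdjointMap f)
    rw [← Functor.partialLeftAdjointHomEquiv_comp, Category.id_comp,
      Functor.partialLeftAdjointHomEquiv_map]

namespace IsCofibrationCategory

variable {Cof : MorphismProperty M} (h : IsCofibrationCategory.{w} W Cof)

include h

theorem exists_isHomotopyColimit_adjunction :
    ∃ (L : Ho W D₁ ⥤ Ho W D₂) (ε : (iColim M F ⋙ γ W D₁) ⋙ L ⟶ colimAlong M F ⋙ γ W D₂)
      (adj : L ⊣ hoRes W F), IsHomotopyColimit W F L ε ∧ ∀ X : ColimDomain M F,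
        adj.unit.app ((γ W D₁).obj X.obj) ≫ (hoRes W F).map (ε.app X) =
          (γ W D₁).map (colimUnit F X) ≫ (resIso W F).hom.app ((colimAlong M F).obj X) :=
  h.exists_homotopyColimit F (γ W D₁) (γ W D₂) (hoRes W F) (resIso W F) (iColim M F)
    (colimAlong M F) (colimUnitNatTrans M F)
    (isUniversalArrow_partialLeftAdjointHomEquiv_id (res M F)) (𝟭 _) (Iso.refl _)

end IsCofibrationCategory

end HomotopyColimit

section HomotopyLimit

variable (M) in
/-- The universal maps `u^* (lim^u X) ⟶ X` as a natural transformation. -/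
noncomputable def limCounitNatTrans : limAlong M F ⋙ res M F ⟶ iLim M F where
  app X := limCounit F X
  naturality X Y f := by
    change (res M F).map ((res M F).partialRightAdjointMap f) ≫
      (res M F).partialRightAdjointHomEquiv (𝟙 _) =
        (res M F).partialRightAdjointHomEquiv (𝟙 _) ≫ f.hom
    rw [← Functor.partialRightAdjointHomEquiv_comp, Category.comp_id,
      Functor.partialRightAdjointHomEquiv_map]

variable (W) in
/-- The localization functor of `D ⥤ M`, seen on the opposite category `Dᵒᵖ ⥤ Mᵒᵖ`. -/
noncomputable abbrev opγ (D : Type w) [SmallCategory D] : (Dᵒᵖ ⥤ Mᵒᵖ) ⥤ (Ho W D)ᵒᵖ :=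
  Functor.opInv D M ⋙ (γ W D).op

instance isLocalization_opγ (D : Type w) [SmallCategory D] :
    (opγ W D).IsLocalization (W.op.functorCategory Dᵒᵖ) :=
  .of_equivalence_source (γ W D).op (W.functorCategory D).op _ _ (Functor.opUnopEquiv D M)
    (fun _ _ _ hf => MorphismProperty.le_isoClosure _ _ fun d => hf d.unop)
    (fun _ _ f hf => Localization.inverts (γ W D).op (W.functorCategory D).op
      ((Functor.opInv D M).map f) fun d => hf (.op d))
    (Iso.refl _)

variable (W) in
/-- The isomorphism `resIso` for the localization functors `opγ` of the opposite categories. -/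
noncomputable def opResIso : res Mᵒᵖ F.op ⋙ opγ W D₁ ≅ opγ W D₂ ⋙ (hoRes W F).op :=
  Functor.isoWhiskerLeft (Functor.opInv D₂ M) (NatIso.op (resIso W F).symm)

lemma isUniversalArrow_res_op_iff {X : D₁ᵒᵖ ⥤ Mᵒᵖ} {V : D₂ᵒᵖ ⥤ Mᵒᵖ}
    (g : X ⟶ (res Mᵒᵖ F.op).obj V) :
    IsUniversalArrow (res Mᵒᵖ F.op) g ↔
      IsCouniversalArrow (res M F) (V := V.unop) (X := X.unop) (NatTrans.unop g) where
  mp hg Y y :=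
    let ⟨l, hl, l_unique⟩ := hg Y.op (NatTrans.op y)
    ⟨NatTrans.unop l, congrArg NatTrans.unop hl, fun l' hl' =>
      congrArg NatTrans.unop (l_unique (NatTrans.op l') (congrArg NatTrans.op hl'))⟩
  mpr hg Y y :=
    let ⟨l, hl, l_unique⟩ := hg Y.unop (NatTrans.unop y)
    ⟨NatTrans.op l, congrArg NatTrans.op hl, fun l' hl' =>
      congrArg NatTrans.op (l_unique (NatTrans.unop l') (congrArg NatTrans.unop hl'))⟩

variable (M) in
/-- Taking opposites sends the diagrams whose colimit along `F.op` exists to those whose limit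
along `F` exists. -/
def colimDomainToLimDomain : ColimDomain Mᵒᵖ F.op ⥤ (LimDomain M F)ᵒᵖ where
  obj X := .op ⟨X.obj.unop, ((isUniversalArrow_res_op_iff F (colimUnit F.op X)).1
    (isUniversalArrow_partialLeftAdjointHomEquiv_id _ X)).rightAdjointObjIsDefined⟩
  map f := (ObjectProperty.homMk (NatTrans.unop f.hom)).op

namespace IsFibrationCategory

variable {Fib : MorphismProperty M} (h : IsFibrationCategory.{w} W Fib)

include h

theorem exists_isHomotopyLimit_adjunction :
    ∃ (R : Ho W D₁ ⥤ Ho W D₂) (ν : limAlong M F ⋙ γ W D₂ ⟶ (iLim M F ⋙ γ W D₁) ⋙ R)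
      (adj : hoRes W F ⊣ R), IsHomotopyLimit W F R ν ∧ ∀ X : LimDomain M F,
        (hoRes W F).map (ν.app X) ≫ adj.counit.app ((γ W D₁).obj X.obj) =
          (resIso W F).inv.app ((limAlong M F).obj X) ≫ (γ W D₁).map (limCounit F X) := by
  have : (Functor.opHom D₁ M).Full := (Functor.opUnopEquiv D₁ M).full_functor
  have : ((iLim M F).op ⋙ Functor.opHom D₁ M).Full := inferInstance
  obtain ⟨L, ε, adj, hL, hadj⟩ := h.op.exists_homotopyColimit F.op (opγ W D₁) (opγ W D₂)
    (hoRes W F).op (opResIso W F) ((iLim M F).op ⋙ Functor.opHom D₁ M)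
    ((limAlong M F).op ⋙ Functor.opHom D₂ M)
    (Functor.whiskerRight (NatTrans.op (limCounitNatTrans M F)) (Functor.opHom D₁ M))
    (fun X => (isUniversalArrow_res_op_iff F _).2
      (isCouniversalArrow_partialRightAdjointHomEquiv_id (res M F) X.unop))
    (colimDomainToLimDomain M F) (Iso.refl _)
  exact ⟨L.unop, NatTrans.unop (F := (iLim M F ⋙ γ W D₁).op ⋙ L)
    (G := (limAlong M F ⋙ γ W D₂).op) ε, adj.unop,
    isLeftKanExtension_of_op (p := iLim M F ⋙ γ W D₁) (t := limAlong M F ⋙ γ W D₂) hL,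
    fun X => congrArg Quiver.Hom.unop (hadj (.op X))⟩

end IsFibrationCategory

end HomotopyLimit

end ABC

theorem mainTheorem2 {M : Type u} [Category.{v} M] (W : MorphismProperty M)
    {D₁ D₂ : Type w} [SmallCategory D₁] [SmallCategory D₂] (F : D₁ ⥤ D₂) :
    (∀ Cof : MorphismProperty M, ABC.IsCofibrationCategory.{w} W Cof →
      (∃ (L : ABC.Ho W D₁ ⥤ ABC.Ho W D₂)
        (ε : (ABC.iColim M F ⋙ ABC.γ W D₁) ⋙ L ⟶ ABC.colimAlong M F ⋙ ABC.γ W D₂),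
        ABC.IsHomotopyColimit W F L ε) ∧
      ∀ (L : ABC.Ho W D₁ ⥤ ABC.Ho W D₂)
        (ε : (ABC.iColim M F ⋙ ABC.γ W D₁) ⋙ L ⟶ ABC.colimAlong M F ⋙ ABC.γ W D₂),
        ABC.IsHomotopyColimit W F L ε →
        ∃ adj : L ⊣ ABC.hoRes W F, ∀ X : ABC.ColimDomain M F,
          adj.unit.app ((ABC.γ W D₁).obj X.obj) ≫ (ABC.hoRes W F).map (ε.app X) =
            (ABC.γ W D₁).map (ABC.colimUnit F X) ≫
              (ABC.resIso W F).hom.app ((ABC.colimAlong M F).obj X)) ∧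
    (∀ Fib : MorphismProperty M, ABC.IsFibrationCategory.{w} W Fib →
      (∃ (R : ABC.Ho W D₁ ⥤ ABC.Ho W D₂)
        (ν : ABC.limAlong M F ⋙ ABC.γ W D₂ ⟶ (ABC.iLim M F ⋙ ABC.γ W D₁) ⋙ R),
        ABC.IsHomotopyLimit W F R ν) ∧
      ∀ (R : ABC.Ho W D₁ ⥤ ABC.Ho W D₂)
        (ν : ABC.limAlong M F ⋙ ABC.γ W D₂ ⟶ (ABC.iLim M F ⋙ ABC.γ W D₁) ⋙ R),
        ABC.IsHomotopyLimit W F R ν →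
        ∃ adj : ABC.hoRes W F ⊣ R, ∀ X : ABC.LimDomain M F,
          (ABC.hoRes W F).map (ν.app X) ≫ adj.counit.app ((ABC.γ W D₁).obj X.obj) =
            (ABC.resIso W F).inv.app ((ABC.limAlong M F).obj X) ≫
              (ABC.γ W D₁).map (ABC.limCounit F X)) := by
  refine ⟨fun Cof h => ?_, fun Fib h => ?_⟩
  · obtain ⟨L, ε, adj, hL, hadj⟩ := h.exists_isHomotopyColimit_adjunction F
    refine ⟨⟨L, ε, hL⟩, fun L' ε' hL' => ?_⟩
    obtain ⟨adj', hadj'⟩ := ABC.exists_adjunction_of_isRightKanExtension hL hL' adj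
    exact ⟨adj', fun X => (hadj' X).trans (hadj X)⟩
  · obtain ⟨R, ν, adj, hR, hadj⟩ := h.exists_isHomotopyLimit_adjunction F
    refine ⟨⟨R, ν, hR⟩, fun R' ν' hR' => ?_⟩
    obtain ⟨adj', hadj'⟩ := ABC.exists_adjunction_of_isLeftKanExtension hR hR' adj
    exact ⟨adj', fun X => (hadj' X).trans (hadj X)⟩
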